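/- Theorem (discounted LQR Bellman equation). Let $A\in\mathbb R^{n\times n}$, $B\in\mathbb R^{n\times m}$, $Q\in\mathbb R^{n\times n}$ symmetric with $Q\succeq 0$, $R\in\mathbb R^{m\times m}$ symmetric with $R\succ 0$, and $\gamma\in(0,1)$. Put $\ell(x,u)=\tfrac12(x^\top Qx+u^\top Ru)$. Let $x_0$ be a square-integrable random vector in $\mathbb R^n$ with mean $\mu_0$ and covariance matrix $\Sigma_0$, and let $w_0,w_1,\dots$ be i.i.d. square-integrable random vectors in $\mathbb R^n$, with $(w_k)_{k\ge0}$ independent of $x_0$, $\mathbb E[w_k]=0$ and $\mathbb E[w_kw_k^\top]=\Sigma_w$. A policy is a sequence $\pi=(\pi_0,\pi_1,\dots)$ of measurable maps $\pi_k:\mathbb R^n\to\mathbb R^m$; under $\pi$ the system evolves by $x_{k+1}=Ax_k+Bu_k+w_k$ with $u_k=\pi_k(x_k)$. Let $$J(\pi)=\mathbb E\Big[\sum_{k=0}^\infty\gamma^k\ell(x_k,u_k)\Big]\in[0,\infty],$$ let $V^\pi(x)\in[0,\infty]$ be the same expectation for the system started at the deterministic state $x_0=x$, and let $V^*(x)=\inf_\pi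 V^\pi(x)$. Assume that $(A,B)$ is stabilizable (there is $K$ such that all eigenvalues of $A+BK$ have modulus less than $1$) and that $(A,Q^{1/2})$ is detectable (there is $L$ such that all eigenvalues of $A+LQ^{1/2}$ have modulus less than $1$), where $Q^{1/2}$ is the positive semidefinite square root of $Q$. Then: 1. $V^*$ satisfies the Bellman equation $$V^*(x)=\inf_{u\in\mathbb R^m}\big\{\ell(x,u)+\gamma\,\mathbb E[V^*(Ax+Bu+w_0)]\big\}\qquad\text{for all }x\in\mathbb R^n.$$ 2. With $A_\gamma=\sqrt\gamma\,A$ and $R_\gamma=\tfrac1\gamma R$, the Riccati equation $$A_\gamma^\top PA_\gamma-P+Q-A_\gamma^\top PB(B^\top PB+R_\gamma)^{-1}B^\top PA_\gamma=0$$ has exactly one symmetric positive semidefinite solution $P$, and $$V^*(x)=\tfrac12\Big(x^\top Px+\tfrac{\gamma}{1-\gamma}\operatorname{tr}(P\Sigma_w)\Big)\qquad\text{for all }x\in\mathbb R^n.$$ 3. Let $F=-(R+\gamma B^\top PB)^{-1}\gamma B^\top PA$, $\pi_F(x)=Fx$ and $\pi^*=(\pi_F,\pi_F,\dots)$. Then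 $J(\pi^*)=\inf_\pi J(\pi)=\mathbb E[V^*(x_0)]$. Moreover $V^{\pi^*}(x)=V^*(x)$ for all $x$, and $\pi^*$ is the only time-invariant policy with this property: for measurable $\varphi:\mathbb R^n\to\mathbb R^m$, $V^{(\varphi,\varphi,\dots)}=V^*$ on $\mathbb R^n$ if and only if $\varphi=\pi_F$. -/

import Mathlib

open MeasureTheory ProbabilityTheory
open scoped ENNReal Matrix MatrixOrder

noncomputable section

namespace DiscountedLQR

/-! Controlled Markov systems `x_{k+1} = f (x_k, u_k, w_k)` with discounted cost. -/

/-- A memoryless policy: a sequence of measurable maps from states to actions. -/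
structure Policy (X U : Type*) [MeasurableSpace X] [MeasurableSpace U] where
  act : ℕ → X → U
  measurable_act : ∀ k, Measurable (act k)

/-- The time-invariant policy `(φ, φ, …)`. -/
def Policy.stationary {X U : Type*} [MeasurableSpace X] [MeasurableSpace U]
    (φ : X → U) (hφ : Measurable φ) : Policy X U :=
  ⟨fun _ => φ, fun _ => hφ⟩

/-- The state trajectory under the policy `π`, from the initial state `x₀`, for a given
realization `w` of the disturbances: `x_{k+1} = f (x_k, π_k x_k, w_k)`. -/
def trajectory {X U W : Type*} [MeasurableSpace X] [MeasurableSpace U]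
    (f : X → U → W → X) (π : Policy X U) (x₀ : X) (w : ℕ → W) : ℕ → X
  | 0 => x₀
  | k + 1 => f (trajectory f π x₀ w k) (π.act k (trajectory f π x₀ w k)) (w k)

/-- The discounted cost `∑ₖ γᵏ ℓ (x_k, u_k)`, `u_k = π_k x_k`, of one realization. The stage cost
`ℓ` is meant to be nonnegative, so that the sum always exists in `[0, ∞]`. -/
def pathCost {X U W : Type*} [MeasurableSpace X] [MeasurableSpace U]
    (f : X → U → W → X) (ℓ : X → U → ℝ) (γ : ℝ) (π : Policy X U) (x₀ : X) (w : ℕ → W) : ℝ≥0∞ :=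
  ∑' k, ENNReal.ofReal
    (γ ^ k * ℓ (trajectory f π x₀ w k) (π.act k (trajectory f π x₀ w k)))

/-- `J(π)`: the expected discounted cost of `π` from the random initial state `x₀`. -/
def cost {Ω X U W : Type*} [MeasurableSpace Ω] [MeasurableSpace X] [MeasurableSpace U]
    (Pr : Measure Ω) (f : X → U → W → X) (ℓ : X → U → ℝ) (γ : ℝ)
    (x₀ : Ω → X) (w : ℕ → Ω → W) (π : Policy X U) : ℝ≥0∞ :=
  ∫⁻ ω, pathCost f ℓ γ π (x₀ ω) (fun k => w k ω) ∂Pr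

/-- `V^π(x)`: the expected discounted cost of `π` when the system starts at `x`. -/
def value {Ω X U W : Type*} [MeasurableSpace Ω] [MeasurableSpace X] [MeasurableSpace U]
    (Pr : Measure Ω) (f : X → U → W → X) (ℓ : X → U → ℝ) (γ : ℝ)
    (w : ℕ → Ω → W) (π : Policy X U) (x : X) : ℝ≥0∞ :=
  ∫⁻ ω, pathCost f ℓ γ π x (fun k => w k ω) ∂Pr

/-- `V*(x) = inf_π V^π(x)`. -/
def optimalValue {Ω X U W : Type*} [MeasurableSpace Ω] [MeasurableSpace X] [MeasurableSpace U]
    (Pr : Measure Ω) (f : X → U → W → X) (ℓ : X → U → ℝ) (γ : ℝ)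
    (w : ℕ → Ω → W) (x : X) : ℝ≥0∞ :=
  ⨅ π : Policy X U, value Pr f ℓ γ w π x

/-- `V` satisfies the Bellman equation
`V(x) = inf_u {ℓ(x, u) + γ E[V(x₁) | x₀ = x, u₀ = u]}`, where `x₁ = f (x, u, w₀)`. -/
def SatisfiesBellman {Ω X U W : Type*} [MeasurableSpace Ω]
    (Pr : Measure Ω) (f : X → U → W → X) (ℓ : X → U → ℝ) (γ : ℝ)
    (w : ℕ → Ω → W) (V : X → ℝ≥0∞) : Prop :=
  ∀ x, V x = ⨅ u : U, (ENNReal.ofReal (ℓ x u) + ENNReal.ofReal γ * ∫⁻ ω, V (f x u (w 0 ω)) ∂Pr)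

/-! The linear-quadratic case. -/

/-- The linear dynamics `f (x, u, w) = A x + B u + w`. -/
def linearDynamics {n m : ℕ} (A : Matrix (Fin n) (Fin n) ℝ) (B : Matrix (Fin n) (Fin m) ℝ)
    (x : Fin n → ℝ) (u : Fin m → ℝ) (w : Fin n → ℝ) : Fin n → ℝ :=
  A *ᵥ x + B *ᵥ u + w

/-- The quadratic stage cost `ℓ (x, u) = ½ (xᵀ Q x + uᵀ R u)`. -/
def quadraticCost {n m : ℕ} (Q : Matrix (Fin n) (Fin n) ℝ) (R : Matrix (Fin m) (Fin m) ℝ)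
    (x : Fin n → ℝ) (u : Fin m → ℝ) : ℝ :=
  (1 / 2) * (x ⬝ᵥ Q *ᵥ x + u ⬝ᵥ R *ᵥ u)

/-- A real square matrix is Schur if all its complex eigenvalues lie in the open unit disc. -/
def IsSchur {n : ℕ} (M : Matrix (Fin n) (Fin n) ℝ) : Prop :=
  ∀ z ∈ spectrum ℂ (M.map Complex.ofReal), ‖z‖ < 1

/-- Discrete-time stabilizability of `(A, B)`. -/
def IsStabilizable {n m : ℕ} (A : Matrix (Fin n) (Fin n) ℝ) (B : Matrix (Fin n) (Fin m) ℝ) :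
    Prop :=
  ∃ K : Matrix (Fin m) (Fin n) ℝ, IsSchur (A + B * K)

/-- Discrete-time detectability of `(A, C)`. -/
def IsDetectable {n p : ℕ} (A : Matrix (Fin n) (Fin n) ℝ) (C : Matrix (Fin p) (Fin n) ℝ) :
    Prop :=
  ∃ L : Matrix (Fin n) (Fin p) ℝ, IsSchur (A + L * C)

/-- `P` solves the discounted algebraic Riccati equation, written with `A_γ = √γ A` and
`R_γ = γ⁻¹ R`. -/
def SolvesRiccati {n m : ℕ} (A : Matrix (Fin n) (Fin n) ℝ) (B : Matrix (Fin n) (Fin m) ℝ)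
    (Q : Matrix (Fin n) (Fin n) ℝ) (R : Matrix (Fin m) (Fin m) ℝ) (γ : ℝ)
    (P : Matrix (Fin n) (Fin n) ℝ) : Prop :=
  let Aγ := Real.sqrt γ • A
  let Rγ := (1 / γ) • R
  Aγᵀ * P * Aγ - P + Q - Aγᵀ * P * B * (Bᵀ * P * B + Rγ)⁻¹ * Bᵀ * P * Aγ = 0

/-- The gain `F = -(R + γ Bᵀ P B)⁻¹ γ Bᵀ P A`. -/
def optimalGain {n m : ℕ} (A : Matrix (Fin n) (Fin n) ℝ) (B : Matrix (Fin n) (Fin m) ℝ)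
    (R : Matrix (Fin m) (Fin m) ℝ) (γ : ℝ) (P : Matrix (Fin n) (Fin n) ℝ) :
    Matrix (Fin m) (Fin n) ℝ :=
  -((R + γ • (Bᵀ * P * B))⁻¹ * (γ • (Bᵀ * P * A)))

/-- The function `½ (xᵀ P x + γ / (1 - γ) · tr (P Σ))`. -/
def quadraticValue {n : ℕ} (γ : ℝ) (P S : Matrix (Fin n) (Fin n) ℝ) (x : Fin n → ℝ) : ℝ :=
  (1 / 2) * (x ⬝ᵥ P *ᵥ x + γ / (1 - γ) * (P * S).trace)

theorem measurable_mulVec {n m : ℕ} (F : Matrix (Fin m) (Fin n) ℝ) :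
    Measurable (fun x : Fin n → ℝ => F *ᵥ x) :=
  (Continuous.matrix_mulVec continuous_const continuous_id).measurable

/-- The time-invariant linear policy `u = F x`. -/
def linearPolicy {n m : ℕ} (F : Matrix (Fin m) (Fin n) ℝ) : Policy (Fin n → ℝ) (Fin m → ℝ) :=
  Policy.stationary (fun x => F *ᵥ x) (measurable_mulVec F)

end DiscountedLQR

end

open DiscountedLQR

/-!
Completing the square in the action shows that one Bellman step maps `½ (xᵀ P x + c)` to
`½ (xᵀ P' x + γ (tr (P Σ_w) + c))`, where `P'` is the image of `P` under the undiscounted Riccati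
map of `√γ A`, `B`, `Q`, `γ⁻¹ R`; the minimizer is a linear feedback, unique because `R ≻ 0`. Hence
value iteration from zero stays quadratic and bounds every policy from below. The matrices increase
along the iteration and are bounded by the cost matrix of a stabilizing feedback, so they converge
to a fixed point, and detectability makes the fixed point unique: under its feedback the running
cost tends to zero, hence so does the state, and at zero all quadratic forms agree. The greedy
feedback of the limit attains the lower bound, so it is optimal. Conversely, the value of a
stationary optimal policy satisfies its own one-step equation, so that its action is the minimizer
at every state.
-/

namespace DiscountedLQR

open Filter Topology

section QuadraticForms

variable {ι κ : Type*}

theorem isSymm_of_posSemidef {P : Matrix ι ι ℝ} (hP : P.PosSemidef) : P.IsSymm := by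
  simpa [Matrix.IsSymm] using hP.isHermitian.eq

variable [Fintype ι] [Fintype κ]

/-- The quadratic form `xᵀ P x` of a real square matrix. -/
def quadForm (P : Matrix ι ι ℝ) (x : ι → ℝ) : ℝ := x ⬝ᵥ P *ᵥ x

theorem quadForm_eq_sum (P : Matrix ι ι ℝ) (x : ι → ℝ) :
    quadForm P x = ∑ i, ∑ j, P i j * (x i * x j) := by
  simp only [quadForm, dotProduct, Matrix.mulVec, Finset.mul_sum, mul_left_comm (x _)]

theorem quadForm_zero (P : Matrix ι ι ℝ) : quadForm P 0 = 0 := by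
  simp [quadForm]

theorem quadForm_smul (P : Matrix ι ι ℝ) (a : ℝ) (x : ι → ℝ) :
    quadForm P (a • x) = a ^ 2 * quadForm P x := by
  simp only [quadForm, Matrix.mulVec_smul, smul_dotProduct, dotProduct_smul, smul_eq_mul]
  ring

theorem quadForm_add {P : Matrix ι ι ℝ} (hP : P.IsSymm) (x y : ι → ℝ) :
    quadForm P (x + y) = quadForm P x + 2 * (x ⬝ᵥ P *ᵥ y) + quadForm P y := by
  have hcomm : y ⬝ᵥ P *ᵥ x = x ⬝ᵥ P *ᵥ y := by
    rw [Matrix.dotProduct_mulVec, ← Matrix.mulVec_transpose, hP.eq, dotProduct_comm]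
  simp only [quadForm, Matrix.mulVec_add, add_dotProduct, dotProduct_add, hcomm]
  ring

theorem quadForm_mulVec (P : Matrix ι ι ℝ) (M : Matrix ι κ ℝ) (x : κ → ℝ) :
    quadForm P (M *ᵥ x) = quadForm (Mᵀ * P * M) x := by
  simp only [quadForm, ← Matrix.mulVec_mulVec, Matrix.dotProduct_mulVec, Matrix.vecMul_transpose]

theorem add_quadForm (P P' : Matrix ι ι ℝ) (x : ι → ℝ) :
    quadForm (P + P') x = quadForm P x + quadForm P' x := by
  simp [quadForm, Matrix.add_mulVec]

theorem sub_quadForm (P P' : Matrix ι ι ℝ) (x : ι → ℝ) :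
    quadForm (P - P') x = quadForm P x - quadForm P' x := by
  simp [quadForm, Matrix.sub_mulVec]

theorem smul_quadForm (c : ℝ) (P : Matrix ι ι ℝ) (x : ι → ℝ) :
    quadForm (c • P) x = c * quadForm P x := by
  simp [quadForm, Matrix.smul_mulVec]

theorem continuous_quadForm (P : Matrix ι ι ℝ) : Continuous (quadForm P) := by
  unfold quadForm
  fun_prop

theorem continuous_quadForm_left (x : ι → ℝ) :
    Continuous fun P : Matrix ι ι ℝ => quadForm P x := by
  unfold quadForm
  fun_prop

theorem quadForm_nonneg {P : Matrix ι ι ℝ} (hP : P.PosSemidef) (x : ι → ℝ) :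
    0 ≤ quadForm P x := by
  simpa [quadForm] using hP.dotProduct_mulVec_nonneg x

theorem quadForm_eq_zero_iff {P : Matrix ι ι ℝ} (hP : P.PosDef) {x : ι → ℝ} :
    quadForm P x = 0 ↔ x = 0 := by
  refine ⟨fun h => ?_, fun h => h ▸ quadForm_zero P⟩
  contrapose! h
  simpa [quadForm] using (hP.dotProduct_mulVec_pos h).ne'

theorem posSemidef_iff_quadForm_nonneg {P : Matrix ι ι ℝ} (hP : P.IsSymm) :
    P.PosSemidef ↔ ∀ x, 0 ≤ quadForm P x :=
  ⟨quadForm_nonneg, fun h => .of_dotProduct_mulVec_nonneg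
    (by rw [Matrix.IsHermitian, Matrix.conjTranspose_eq_transpose_of_trivial, hP.eq])
    (by simpa [quadForm] using h)⟩

theorem le_iff_quadForm_le {P P' : Matrix ι ι ℝ} (hP : P.IsSymm) (hP' : P'.IsSymm) :
    P ≤ P' ↔ ∀ x, quadForm P x ≤ quadForm P' x := by
  simp only [Matrix.le_iff, posSemidef_iff_quadForm_nonneg (hP'.sub hP), sub_quadForm, sub_nonneg]

theorem quadForm_le_of_le {P P' : Matrix ι ι ℝ} (h : P ≤ P') (x : ι → ℝ) :
    quadForm P x ≤ quadForm P' x := by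
  simpa only [sub_quadForm, sub_nonneg] using quadForm_nonneg (Matrix.le_iff.mp h) x

theorem apply_eq_quadForm [DecidableEq ι] {P : Matrix ι ι ℝ} (hP : P.IsSymm) (i j : ι) :
    P i j = (quadForm P (Pi.single i 1 + Pi.single j 1) - quadForm P (Pi.single i 1)
      - quadForm P (Pi.single j 1)) / 2 := by
  have hcross : Pi.single i 1 ⬝ᵥ P *ᵥ Pi.single j 1 = P i j := by simp
  rw [quadForm_add hP, hcross]
  ring

theorem quadForm_add_two_mul_eq [DecidableEq ι] {M : Matrix ι ι ℝ} (hM : M.PosDef)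
    (G : Matrix ι κ ℝ) (u : ι → ℝ) (x : κ → ℝ) :
    quadForm M u + 2 * (u ⬝ᵥ G *ᵥ x) =
      quadForm M (u + M⁻¹ *ᵥ (G *ᵥ x)) - quadForm (Gᵀ * M⁻¹ * G) x := by
  have hsymm := isSymm_of_posSemidef hM.posSemidef
  have hunit := (Matrix.isUnit_iff_isUnit_det _).mp hM.isUnit
  have hsq : quadForm M (M⁻¹ *ᵥ (G *ᵥ x)) = quadForm (Gᵀ * M⁻¹ * G) x := by
    rw [← quadForm_mulVec, quadForm_mulVec M, Matrix.transpose_nonsing_inv, hsymm.eq,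
      Matrix.nonsing_inv_mul _ hunit, Matrix.one_mul]
  rw [quadForm_add hsymm, Matrix.mulVec_mulVec, Matrix.mul_nonsing_inv _ hunit,
    Matrix.one_mulVec, hsq]
  ring

open scoped Classical in
theorem quadForm_eq_sqrt_dotProduct {P : Matrix ι ι ℝ} (hP : P.PosSemidef) (x : ι → ℝ) :
    quadForm P x = (CFC.sqrt P *ᵥ x) ⬝ᵥ (CFC.sqrt P *ᵥ x) := by
  have hsymm := isSymm_of_posSemidef (Matrix.nonneg_iff_posSemidef.mp (CFC.sqrt_nonneg P))
  conv_lhs => rw [quadForm, ← CFC.sqrt_mul_sqrt_self P hP.nonneg]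
  rw [← Matrix.mulVec_mulVec, Matrix.dotProduct_mulVec, ← Matrix.mulVec_transpose, hsymm.eq]

open scoped Classical in
theorem tendsto_sqrt_mulVec_of_quadForm {P : Matrix ι ι ℝ} (hP : P.PosSemidef) {x : ℕ → ι → ℝ}
    (h : Tendsto (fun k => quadForm P (x k)) atTop (𝓝 0)) :
    Tendsto (fun k => CFC.sqrt P *ᵥ x k) atTop (𝓝 0) := by
  have hsqrt : Tendsto (fun k => √(quadForm P (x k))) atTop (𝓝 0) := by
    simpa using h.sqrt
  refine tendsto_pi_nhds.mpr fun i => squeeze_zero_norm (fun k => Real.abs_le_sqrt ?_) hsqrt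
  rw [quadForm_eq_sqrt_dotProduct hP, dotProduct, sq]
  exact Finset.single_le_sum (f := fun j => (CFC.sqrt P *ᵥ x k) j * (CFC.sqrt P *ᵥ x k) j)
    (fun j _ => mul_self_nonneg _) (Finset.mem_univ i)

theorem tendsto_zero_of_quadForm {P : Matrix ι ι ℝ} (hP : P.PosDef) {x : ℕ → ι → ℝ}
    (h : Tendsto (fun k => quadForm P (x k)) atTop (𝓝 0)) : Tendsto x atTop (𝓝 0) := by
  classical
  have hinv : P⁻¹ * CFC.sqrt P * CFC.sqrt P = 1 := by
    rw [mul_assoc, CFC.sqrt_mul_sqrt_self P hP.posSemidef.nonneg,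
      Matrix.nonsing_inv_mul _ ((Matrix.isUnit_iff_isUnit_det _).mp hP.isUnit)]
  have hcont : Continuous fun v : ι → ℝ => (P⁻¹ * CFC.sqrt P) *ᵥ v := by fun_prop
  simpa [Function.comp_def, Matrix.mulVec_mulVec, hinv] using
    (hcont.tendsto 0).comp (tendsto_sqrt_mulVec_of_quadForm hP.posSemidef h)

end QuadraticForms

section FiniteIndex

variable {ι κ : Type*}

theorem posDef_transpose_mul_mul_add [Fintype ι] [Finite κ] {P : Matrix ι ι ℝ} {R : Matrix κ κ ℝ}
    {B : Matrix ι κ ℝ} (hR : R.PosDef) (hP : P.PosSemidef) : (Bᵀ * P * B + R).PosDef :=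
  hR.posSemidef_add (by simpa using hP.conjTranspose_mul_mul_same B)

theorem posSemidef_of_tendsto [Finite ι] {P : ℕ → Matrix ι ι ℝ} {P' : Matrix ι ι ℝ}
    (hP : ∀ N, (P N).PosSemidef) (hlim : Tendsto P atTop (𝓝 P')) : P'.PosSemidef := by
  have := Fintype.ofFinite ι
  have hsymm : P'.IsSymm := tendsto_nhds_unique
    (((continuous_id.matrix_transpose).tendsto P').comp hlim)
    (hlim.congr fun N => (isSymm_of_posSemidef (hP N)).eq.symm)
  exact (posSemidef_iff_quadForm_nonneg hsymm).mpr fun x =>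
    ge_of_tendsto' (((continuous_quadForm_left x).tendsto P').comp hlim)
      fun N => quadForm_nonneg (hP N) x

theorem exists_tendsto_of_monotone [Finite ι] {P : ℕ → Matrix ι ι ℝ}
    (hP : ∀ N, (P N).IsSymm) (hmono : Monotone P) (hbdd : BddAbove (Set.range P)) :
    ∃ P', Tendsto P atTop (𝓝 P') := by
  classical
  have := Fintype.ofFinite ι
  obtain ⟨W, hW⟩ := hbdd
  have hform (x : ι → ℝ) : ∃ l, Tendsto (fun N => quadForm (P N) x) atTop (𝓝 l) :=
    ⟨_, tendsto_atTop_ciSup (fun N N' h => quadForm_le_of_le (hmono h) x)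
      ⟨quadForm W x, by rintro _ ⟨N, rfl⟩; exact quadForm_le_of_le (hW ⟨N, rfl⟩) x⟩⟩
  choose l hl using hform
  refine ⟨.of fun i j => (l (Pi.single i 1 + Pi.single j 1) - l (Pi.single i 1)
    - l (Pi.single j 1)) / 2, tendsto_pi_nhds.mpr fun i => tendsto_pi_nhds.mpr fun j => ?_⟩
  simp_rw [fun N => apply_eq_quadForm (hP N) i j]
  exact (((hl _).sub (hl _)).sub (hl _)).div_const 2

end FiniteIndex

section Riccati

variable {ι κ : Type*} [Fintype ι] [Fintype κ] [DecidableEq κ]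

/-- The right-hand side of the undiscounted discrete-time Riccati equation. The discounted equation
is the undiscounted one for `√γ A` and `γ⁻¹ R`. -/
noncomputable def riccatiMap (A : Matrix ι ι ℝ) (B : Matrix ι κ ℝ) (Q : Matrix ι ι ℝ)
    (R : Matrix κ κ ℝ) (P : Matrix ι ι ℝ) : Matrix ι ι ℝ :=
  Aᵀ * P * A + Q - Aᵀ * P * B * (Bᵀ * P * B + R)⁻¹ * Bᵀ * P * A

/-- The gain `-(Bᵀ P B + R)⁻¹ Bᵀ P A` of the feedback minimizing the one-step cost with terminal
cost `xᵀ P x`. -/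
noncomputable def riccatiGain (A : Matrix ι ι ℝ) (B : Matrix ι κ ℝ) (R : Matrix κ κ ℝ)
    (P : Matrix ι ι ℝ) : Matrix κ ι ℝ :=
  -((Bᵀ * P * B + R)⁻¹ * (Bᵀ * P * A))

variable {A : Matrix ι ι ℝ} {B : Matrix ι κ ℝ} {Q : Matrix ι ι ℝ} {R : Matrix κ κ ℝ}
  {P P' : Matrix ι ι ℝ}

theorem quadForm_step_eq (hR : R.PosDef) (hP : P.PosSemidef) (x : ι → ℝ) (u : κ → ℝ) :
    quadForm Q x + quadForm R u + quadForm P (A *ᵥ x + B *ᵥ u) =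
      quadForm (riccatiMap A B Q R P) x +
        quadForm (Bᵀ * P * B + R) (u - riccatiGain A B R P *ᵥ x) := by
  have hP_symm := isSymm_of_posSemidef hP
  have hsquare := quadForm_add_two_mul_eq (posDef_transpose_mul_mul_add (B := B) hR hP)
    (Bᵀ * P * A) u x
  have hgain : u - riccatiGain A B R P *ᵥ x =
      u + (Bᵀ * P * B + R)⁻¹ *ᵥ ((Bᵀ * P * A) *ᵥ x) := by
    rw [riccatiGain, Matrix.neg_mulVec, sub_neg_eq_add, Matrix.mulVec_mulVec]
  have hcross : (A *ᵥ x) ⬝ᵥ P *ᵥ (B *ᵥ u) = u ⬝ᵥ (Bᵀ * P * A) *ᵥ x := by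
    rw [← Matrix.mulVec_mulVec, ← Matrix.mulVec_mulVec, Matrix.dotProduct_mulVec u,
      Matrix.vecMul_transpose, Matrix.dotProduct_mulVec (A *ᵥ x), ← Matrix.mulVec_transpose,
      hP_symm.eq, dotProduct_comm]
  have hmap : riccatiMap A B Q R P =
      Aᵀ * P * A + Q - (Bᵀ * P * A)ᵀ * (Bᵀ * P * B + R)⁻¹ * (Bᵀ * P * A) := by
    simp only [riccatiMap, Matrix.transpose_mul, Matrix.transpose_transpose, hP_symm.eq,
      Matrix.mul_assoc]
  rw [hgain, hmap, quadForm_add hP_symm, hcross, sub_quadForm, add_quadForm, quadForm_mulVec P A,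
    quadForm_mulVec P B]
  rw [add_quadForm] at hsquare
  linear_combination hsquare

theorem quadForm_riccatiMap_eq (hR : R.PosDef) (hP : P.PosSemidef) (x : ι → ℝ) :
    quadForm (riccatiMap A B Q R P) x =
      quadForm Q x + quadForm R (riccatiGain A B R P *ᵥ x) +
        quadForm P (A *ᵥ x + B *ᵥ (riccatiGain A B R P *ᵥ x)) := by
  rw [quadForm_step_eq hR hP, sub_self, quadForm_zero, add_zero]

theorem quadForm_riccatiMap_le (hR : R.PosDef) (hP : P.PosSemidef) (x : ι → ℝ) (u : κ → ℝ) :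
    quadForm (riccatiMap A B Q R P) x ≤
      quadForm Q x + quadForm R u + quadForm P (A *ᵥ x + B *ᵥ u) := by
  rw [quadForm_step_eq hR hP]
  exact le_add_of_nonneg_right
    (quadForm_nonneg (posDef_transpose_mul_mul_add hR hP).posSemidef _)

theorem isSymm_riccatiMap (hQ : Q.IsSymm) (hR : R.IsSymm) (hP : P.IsSymm) :
    (riccatiMap A B Q R P).IsSymm := by
  simp only [Matrix.IsSymm, riccatiMap, Matrix.transpose_sub, Matrix.transpose_add,
    Matrix.transpose_mul, Matrix.transpose_transpose, Matrix.transpose_nonsing_inv, hQ.eq, hR.eq,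
    hP.eq, Matrix.mul_assoc]

theorem posSemidef_riccatiMap (hQ : Q.PosSemidef) (hR : R.PosDef) (hP : P.PosSemidef) :
    (riccatiMap A B Q R P).PosSemidef := by
  rw [posSemidef_iff_quadForm_nonneg (isSymm_riccatiMap (isSymm_of_posSemidef hQ)
    (isSymm_of_posSemidef hR.posSemidef) (isSymm_of_posSemidef hP))]
  intro x
  rw [quadForm_riccatiMap_eq hR hP]
  exact add_nonneg (add_nonneg (quadForm_nonneg hQ _) (quadForm_nonneg hR.posSemidef _))
    (quadForm_nonneg hP _)

theorem riccatiMap_mono (hQ : Q.IsSymm) (hR : R.PosDef) (hP : P.PosSemidef)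
    (hP' : P'.PosSemidef) (h : P ≤ P') : riccatiMap A B Q R P ≤ riccatiMap A B Q R P' := by
  have hR_symm := isSymm_of_posSemidef hR.posSemidef
  rw [le_iff_quadForm_le (isSymm_riccatiMap hQ hR_symm (isSymm_of_posSemidef hP))
    (isSymm_riccatiMap hQ hR_symm (isSymm_of_posSemidef hP'))]
  intro x
  rw [quadForm_riccatiMap_eq hR hP']
  exact (quadForm_riccatiMap_le hR hP x _).trans (by gcongr; exact quadForm_le_of_le h _)

theorem continuousAt_riccatiMap (hR : R.PosDef) (hP : P.PosSemidef) :
    ContinuousAt (riccatiMap A B Q R) P := by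
  have hdet : (Bᵀ * P * B + R).det ≠ 0 :=
    ((Matrix.isUnit_iff_isUnit_det _).mp (posDef_transpose_mul_mul_add hR hP).isUnit).ne_zero
  have hinv : ContinuousAt (fun P : Matrix ι ι ℝ => (Bᵀ * P * B + R)⁻¹) P := by
    refine ContinuousAt.comp (f := fun P : Matrix ι ι ℝ => Bᵀ * P * B + R)
      (g := fun M : Matrix κ κ ℝ => M⁻¹) (continuousAt_matrix_inv _ ?_) (by fun_prop)
    rw [Ring.inverse_eq_inv']
    exact continuousAt_inv₀ hdet
  have hprod : Continuous fun p : Matrix ι ι ℝ × Matrix κ κ ℝ =>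
      Aᵀ * p.1 * A + Q - Aᵀ * p.1 * B * p.2 * Bᵀ * p.1 * A := by fun_prop
  exact ContinuousAt.comp (f := fun P : Matrix ι ι ℝ => (P, (Bᵀ * P * B + R)⁻¹))
    hprod.continuousAt (continuousAt_id.prodMk hinv)

end Riccati

section Schur

theorem summable_norm_pow_of_spectralRadius_lt_one {𝔸 : Type*} [NormedRing 𝔸] [NormedAlgebra ℂ 𝔸]
    [CompleteSpace 𝔸] {a : 𝔸} (ha : spectralRadius ℂ a < 1) : Summable fun k => ‖a ^ k‖ := by
  obtain ⟨r, har, hr⟩ := ENNReal.lt_iff_exists_nnreal_btwn.mp ha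
  have hroot := (spectrum.pow_nnnorm_pow_one_div_tendsto_nhds_spectralRadius a).eventually_lt_const
    har
  refine Summable.of_norm_bounded_eventually_nat
    (summable_geometric_of_lt_one r.coe_nonneg (by exact_mod_cast hr)) ?_
  filter_upwards [hroot, eventually_gt_atTop 0] with k hk hk_pos
  have hpow := ENNReal.rpow_lt_rpow hk (Nat.cast_pos.mpr hk_pos)
  rw [← ENNReal.rpow_mul, one_div, inv_mul_cancel₀ (Nat.cast_ne_zero.mpr hk_pos.ne'),
    ENNReal.rpow_one, ENNReal.rpow_natCast] at hpow
  rw [norm_norm]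
  exact_mod_cast hpow.le

open scoped Matrix.Norms.Operator

variable {n : ℕ} {M : Matrix (Fin n) (Fin n) ℝ}

theorem IsSchur.summable_norm_pow (hM : IsSchur M) : Summable fun k => ‖M ^ k‖ := by
  rcases subsingleton_or_nontrivial (Matrix (Fin n) (Fin n) ℂ) with h | h
  · have (k : ℕ) : M ^ k = 0 := Matrix.map_injective Complex.ofReal_injective (h.elim _ _)
    simp [this, summable_zero]
  have hnorm (k : ℕ) : ‖M.map Complex.ofReal ^ k‖ = ‖M ^ k‖ := by
    have hmap : M.map Complex.ofReal ^ k = (M ^ k).map Complex.ofReal :=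
      (map_pow (Complex.ofRealHom.mapMatrix (m := Fin n)) M k).symm
    rw [hmap]
    simp [Matrix.linfty_opNorm_def]
  simp_rw [← hnorm]
  refine summable_norm_pow_of_spectralRadius_lt_one ?_
  exact spectrum.spectralRadius_lt_of_forall_lt (r := 1) _ fun z hz => by
    simpa [← NNReal.coe_lt_coe] using hM z hz

theorem IsSchur.transpose (hM : IsSchur M) : IsSchur Mᵀ := by
  intro z hz
  rw [Matrix.transpose_map, Matrix.mem_spectrum_iff_isRoot_charpoly,
    Matrix.charpoly_transpose, ← Matrix.mem_spectrum_iff_isRoot_charpoly] at hz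
  exact hM z hz

theorem IsSchur.smul (hM : IsSchur M) {c : ℝ} (hc : |c| ≤ 1) : IsSchur (c • M) := by
  intro z hz
  rcases subsingleton_or_nontrivial (Matrix (Fin n) (Fin n) ℂ) with h | h
  · simp [spectrum.of_subsingleton] at hz
  have hmap : (c • M).map Complex.ofReal = (c : ℂ) • M.map Complex.ofReal := by
    ext
    simp
  rw [hmap, spectrum.smul_eq_smul _ _
    (spectrum.nonempty_of_isAlgClosed_of_finiteDimensional ℂ _)] at hz
  obtain ⟨z', hz', rfl⟩ := hz
  calc ‖(c : ℂ) • z'‖ = |c| * ‖z'‖ := by rw [norm_smul, Complex.norm_real, Real.norm_eq_abs]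
    _ ≤ ‖z'‖ := mul_le_of_le_one_left (norm_nonneg _) hc
    _ < 1 := hM z' hz'

theorem IsStabilizable.smul {m : ℕ} {B : Matrix (Fin n) (Fin m) ℝ} (h : IsStabilizable M B)
    {c : ℝ} (hc : |c| ≤ 1) : IsStabilizable (c • M) B := by
  obtain ⟨K, hK⟩ := h
  exact ⟨c • K, by simpa only [Matrix.mul_smul, smul_add] using hK.smul hc⟩

theorem IsDetectable.smul {p : ℕ} {C : Matrix (Fin p) (Fin n) ℝ} (h : IsDetectable M C)
    {c : ℝ} (hc : |c| ≤ 1) : IsDetectable (c • M) C := by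
  obtain ⟨L, hL⟩ := h
  exact ⟨c • L, by simpa only [Matrix.smul_mul, smul_add] using hL.smul hc⟩

theorem IsSchur.exists_eq_add_transpose_mul_mul (hM : IsSchur M) {S : Matrix (Fin n) (Fin n) ℝ}
    (hS : S.PosSemidef) :
    ∃ W : Matrix (Fin n) (Fin n) ℝ, W.PosSemidef ∧ W = S + Mᵀ * W * M := by
  have hsum : Summable fun k => Mᵀ ^ k * S * M ^ k := by
    obtain ⟨C, hC⟩ := hM.transpose.summable_norm_pow.tendsto_atTop_zero.bddAbove_range
    refine .of_norm_bounded (hM.summable_norm_pow.mul_left (C * ‖S‖)) fun k => ?_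
    refine (norm_mul_le _ _).trans ?_
    gcongr
    refine (norm_mul_le _ _).trans ?_
    gcongr
    exact hC ⟨k, rfl⟩
  have hnonneg (k : ℕ) : (Mᵀ ^ k * S * M ^ k).PosSemidef := by
    simpa [Matrix.transpose_pow] using hS.conjTranspose_mul_mul_same (M ^ k)
  refine ⟨∑' k, Mᵀ ^ k * S * M ^ k, posSemidef_of_tendsto
    (fun N => Matrix.posSemidef_sum _ fun k _ => hnonneg k) hsum.hasSum.tendsto_sum_nat, ?_⟩
  calc ∑' k, Mᵀ ^ k * S * M ^ k = S + ∑' k, Mᵀ ^ (k + 1) * S * M ^ (k + 1) := by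
        rw [hsum.tsum_eq_zero_add, pow_zero, pow_zero, one_mul, mul_one]
    _ = S + ∑' k, Mᵀ * (Mᵀ ^ k * S * M ^ k) * M := by
        simp only [pow_succ' Mᵀ, pow_succ M, mul_assoc]
    _ = S + Mᵀ * (∑' k, Mᵀ ^ k * S * M ^ k) * M := by
        rw [(hsum.mul_left _).tsum_mul_right, hsum.tsum_mul_left]

end Schur

section AffineRecursions

theorem tendsto_sum_range_mul_zero {b c : ℕ → ℝ} (hb : Summable b) (hc : Tendsto c atTop (𝓝 0)) :
    Tendsto (fun k => ∑ j ∈ Finset.range k, b j * c (k - 1 - j)) atTop (𝓝 0) := by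
  obtain ⟨C, hC⟩ := hc.norm.bddAbove_range
  have hterm (j : ℕ) :
      Tendsto (fun k => if j < k then b j * c (k - 1 - j) else 0) atTop (𝓝 0) := by
    have hindex : Tendsto (fun k => k - 1 - j) atTop atTop :=
      (tendsto_sub_atTop_nat j).comp (tendsto_sub_atTop_nat 1)
    have hmul : Tendsto (fun k => b j * c (k - 1 - j)) atTop (𝓝 0) := by
      simpa only [mul_zero, Function.comp_def] using (hc.comp hindex).const_mul (b j)
    refine hmul.congr' ?_
    filter_upwards [eventually_gt_atTop j] with k hk
    rw [if_pos hk]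
  have hbound (k j : ℕ) : ‖if j < k then b j * c (k - 1 - j) else 0‖ ≤ ‖b j‖ * C := by
    split_ifs
    · exact (norm_mul_le _ _).trans (by gcongr; exact hC ⟨_, rfl⟩)
    · rw [norm_zero]
      exact mul_nonneg (norm_nonneg _) ((norm_nonneg _).trans (hC ⟨0, rfl⟩))
  have hlim := tendsto_tsum_of_dominated_convergence (hb.norm.mul_right C) hterm
    (Eventually.of_forall hbound)
  rw [tsum_zero] at hlim
  refine hlim.congr fun k => ?_
  rw [tsum_eq_sum (s := Finset.range k) fun j hj => if_neg (by simpa using hj)]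
  exact Finset.sum_congr rfl fun j hj => if_pos (Finset.mem_range.mp hj)

variable {𝕜 E : Type*} [NontriviallyNormedField 𝕜] [NormedAddCommGroup E] [NormedSpace 𝕜 E]
  {T : E →L[𝕜] E} {z g : ℕ → E}

theorem norm_le_of_affine_recursion (hz : ∀ k, z (k + 1) = T (z k) + g k) (k : ℕ) :
    ‖z k‖ ≤ ‖T ^ k‖ * ‖z 0‖ + ∑ j ∈ Finset.range k, ‖T ^ j‖ * ‖g (k - 1 - j)‖ := by
  have hsol : z k = (T ^ k) (z 0) + ∑ j ∈ Finset.range k, (T ^ j) (g (k - 1 - j)) := by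
    induction k with
    | zero => simp
    | succ k ih =>
      rw [hz, ih, Finset.sum_range_succ', map_add, map_sum, add_assoc]
      simp [pow_succ', Nat.sub_sub, add_comm 1]
  rw [hsol]
  exact (norm_add_le _ _).trans (add_le_add ((T ^ k).le_opNorm _)
    ((norm_sum_le _ _).trans (Finset.sum_le_sum fun j _ => (T ^ j).le_opNorm _)))

theorem tendsto_zero_of_affine_recursion (hT : Summable fun k => ‖T ^ k‖)
    (hz : ∀ k, z (k + 1) = T (z k) + g k) (hg : Tendsto g atTop (𝓝 0)) :
    Tendsto z atTop (𝓝 0) := by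
  have hbound := (hT.tendsto_atTop_zero.mul_const ‖z 0‖).add
    (tendsto_sum_range_mul_zero hT (tendsto_zero_iff_norm_tendsto_zero.mp hg))
  rw [zero_mul, add_zero] at hbound
  exact squeeze_zero_norm (norm_le_of_affine_recursion hz) hbound

open scoped Matrix.Norms.Operator in
theorem IsSchur.tendsto_zero_of_affine_recursion {n : ℕ} {M : Matrix (Fin n) (Fin n) ℝ}
    (hM : IsSchur M) {z g : ℕ → Fin n → ℝ} (hz : ∀ k, z (k + 1) = M *ᵥ z k + g k)
    (hg : Tendsto g atTop (𝓝 0)) : Tendsto z atTop (𝓝 0) := by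
  let T : (Fin n → ℝ) →L[ℝ] (Fin n → ℝ) := .mk M.mulVecLin
  have hT (k : ℕ) : T ^ k = .mk (M ^ k).mulVecLin := by
    refine ContinuousLinearMap.coe_injective ?_
    simp [T, ← Matrix.toLin'_apply', Matrix.toLin'_pow]
  have hsum : Summable fun k => ‖T ^ k‖ :=
    hM.summable_norm_pow.congr fun k => by rw [hT, Matrix.linfty_opNorm_eq_opNorm]
  exact DiscountedLQR.tendsto_zero_of_affine_recursion hsum hz hg

end AffineRecursions

section AlgebraicRiccatiEquation

variable {n m : ℕ} {A : Matrix (Fin n) (Fin n) ℝ} {B : Matrix (Fin n) (Fin m) ℝ}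
  {Q : Matrix (Fin n) (Fin n) ℝ} {R : Matrix (Fin m) (Fin m) ℝ} {P P' : Matrix (Fin n) (Fin n) ℝ}

theorem IsDetectable.tendsto_zero {p : ℕ} {C : Matrix (Fin p) (Fin n) ℝ} (hdet : IsDetectable A C)
    {x g : ℕ → Fin n → ℝ} (hx : ∀ k, x (k + 1) = A *ᵥ x k + g k)
    (hg : Tendsto g atTop (𝓝 0)) (hy : Tendsto (fun k => C *ᵥ x k) atTop (𝓝 0)) :
    Tendsto x atTop (𝓝 0) := by
  obtain ⟨L, hL⟩ := hdet
  have hcont : Continuous fun v : Fin p → ℝ => L *ᵥ v := by fun_prop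
  have hcorr : Tendsto (fun k => g k - L *ᵥ (C *ᵥ x k)) atTop (𝓝 0) := by
    simpa using hg.sub ((hcont.tendsto 0).comp hy)
  refine hL.tendsto_zero_of_affine_recursion (fun k => ?_) hcorr
  rw [hx, Matrix.add_mulVec, ← Matrix.mulVec_mulVec]
  abel

theorem tendsto_zero_of_riccatiMap_eq_self (hQ : Q.PosSemidef) (hR : R.PosDef)
    (hP : P.PosSemidef) (hfix : riccatiMap A B Q R P = P) (hdet : IsDetectable A (CFC.sqrt Q))
    {x : ℕ → Fin n → ℝ}
    (hx : ∀ k, x (k + 1) = A *ᵥ x k + B *ᵥ (riccatiGain A B R P *ᵥ x k)) :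
    Tendsto x atTop (𝓝 0) := by
  set u : ℕ → Fin m → ℝ := fun k => riccatiGain A B R P *ᵥ x k
  have hdrop (k : ℕ) : quadForm P (x k) - quadForm P (x (k + 1)) =
      quadForm Q (x k) + quadForm R (u k) := by
    have hstep := quadForm_riccatiMap_eq (A := A) (B := B) (Q := Q) hR hP (x k)
    rw [hfix, ← hx] at hstep
    rw [hstep, add_sub_cancel_right]
  have hQ_nonneg (k : ℕ) := quadForm_nonneg hQ (x k)
  have hR_nonneg (k : ℕ) := quadForm_nonneg hR.posSemidef (u k)
  have hanti : Antitone fun k => quadForm P (x k) :=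
    antitone_nat_of_succ_le fun k => by linarith [hdrop k, hQ_nonneg k, hR_nonneg k]
  have hlim := tendsto_atTop_ciInf hanti
    ⟨0, by rintro _ ⟨k, rfl⟩; exact quadForm_nonneg hP (x k)⟩
  have hcost : Tendsto (fun k => quadForm Q (x k) + quadForm R (u k)) atTop (𝓝 0) := by
    simpa [hdrop] using hlim.sub (hlim.comp (tendsto_add_atTop_nat 1))
  have hQx := squeeze_zero hQ_nonneg (fun k => le_add_of_nonneg_right (hR_nonneg k)) hcost
  have hRu := squeeze_zero hR_nonneg (fun k => le_add_of_nonneg_left (hQ_nonneg k)) hcost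
  have hcont : Continuous fun v : Fin m → ℝ => B *ᵥ v := by fun_prop
  have hBu := (hcont.tendsto 0).comp (tendsto_zero_of_quadForm hR hRu)
  rw [Matrix.mulVec_zero] at hBu
  exact hdet.tendsto_zero hx hBu (tendsto_sqrt_mulVec_of_quadForm hQ hQx)

/-- Along the closed loop of `P`, the difference of the two quadratic forms decreases to zero. -/
theorem le_of_riccatiMap_eq_self (hQ : Q.PosSemidef) (hR : R.PosDef)
    (hdet : IsDetectable A (CFC.sqrt Q)) (hP : P.PosSemidef) (hP' : P'.PosSemidef)
    (hfix : riccatiMap A B Q R P = P) (hfix' : riccatiMap A B Q R P' = P') : P' ≤ P := by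
  rw [le_iff_quadForm_le (isSymm_of_posSemidef hP') (isSymm_of_posSemidef hP)]
  intro x₀
  set F := riccatiGain A B R P with hF
  let x : ℕ → Fin n → ℝ := fun k => (A + B * F) ^ k *ᵥ x₀
  have hx (k : ℕ) : x (k + 1) = A *ᵥ x k + B *ᵥ (F *ᵥ x k) := by
    simp only [x, pow_succ', ← Matrix.mulVec_mulVec, Matrix.add_mulVec]
  have hanti : Antitone fun k => quadForm P (x k) - quadForm P' (x k) := by
    refine antitone_nat_of_succ_le fun k => ?_
    have hstep := quadForm_riccatiMap_eq (A := A) (B := B) (Q := Q) hR hP (x k)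
    have hstep' := quadForm_riccatiMap_le (A := A) (B := B) (Q := Q) hR hP' (x k) (F *ᵥ x k)
    rw [hfix, ← hF, ← hx] at hstep
    rw [hfix', ← hx] at hstep'
    linarith
  have hx_lim := tendsto_zero_of_riccatiMap_eq_self hQ hR hP hfix hdet hx
  have hlim : Tendsto (fun k => quadForm P (x k) - quadForm P' (x k)) atTop (𝓝 0) := by
    simpa [quadForm_zero] using (((continuous_quadForm P).tendsto 0).comp hx_lim).sub
      (((continuous_quadForm P').tendsto 0).comp hx_lim)
  simpa [x] using hanti.le_of_tendsto hlim 0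

theorem eq_of_riccatiMap_eq_self (hQ : Q.PosSemidef) (hR : R.PosDef)
    (hdet : IsDetectable A (CFC.sqrt Q)) (hP : P.PosSemidef) (hP' : P'.PosSemidef)
    (hfix : riccatiMap A B Q R P = P) (hfix' : riccatiMap A B Q R P' = P') : P = P' :=
  le_antisymm (le_of_riccatiMap_eq_self hQ hR hdet hP' hP hfix' hfix)
    (le_of_riccatiMap_eq_self hQ hR hdet hP hP' hfix hfix')

variable (A B Q R) in
/-- The Riccati iteration started at zero: `xᵀ P_N x` is the optimal cost of the deterministic
problem over `N` steps. -/
noncomputable def riccatiIter (N : ℕ) : Matrix (Fin n) (Fin n) ℝ := (riccatiMap A B Q R)^[N] 0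

theorem riccatiIter_succ (N : ℕ) :
    riccatiIter A B Q R (N + 1) = riccatiMap A B Q R (riccatiIter A B Q R N) :=
  Function.iterate_succ_apply' _ _ _

theorem posSemidef_riccatiIter (hQ : Q.PosSemidef) (hR : R.PosDef) (N : ℕ) :
    (riccatiIter A B Q R N).PosSemidef := by
  induction N with
  | zero => exact .zero
  | succ N ih => exact riccatiIter_succ (A := A) N ▸ posSemidef_riccatiMap hQ hR ih

theorem monotone_riccatiIter (hQ : Q.PosSemidef) (hR : R.PosDef) :
    Monotone (riccatiIter A B Q R) := by
  refine monotone_nat_of_le_succ fun N => ?_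
  induction N with
  | zero => exact (posSemidef_riccatiIter hQ hR 1).nonneg
  | succ N ih =>
    rw [riccatiIter_succ, riccatiIter_succ (N + 1)]
    exact riccatiMap_mono (isSymm_of_posSemidef hQ) hR (posSemidef_riccatiIter hQ hR N)
      (posSemidef_riccatiIter hQ hR (N + 1)) ih

/-- The cost matrix of a stabilizing feedback is a bound. -/
theorem IsStabilizable.bddAbove_range_riccatiIter (hstab : IsStabilizable A B)
    (hQ : Q.PosSemidef) (hR : R.PosDef) : BddAbove (Set.range (riccatiIter A B Q R)) := by
  obtain ⟨K, hK⟩ := hstab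
  have hS : (Q + Kᵀ * R * K).PosSemidef :=
    hQ.add (by simpa using hR.posSemidef.conjTranspose_mul_mul_same K)
  obtain ⟨W, hW, hW_eq⟩ := hK.exists_eq_add_transpose_mul_mul hS
  have hW_form (x : Fin n → ℝ) : quadForm W x =
      quadForm Q x + quadForm R (K *ᵥ x) + quadForm W (A *ᵥ x + B *ᵥ (K *ᵥ x)) := by
    conv_lhs => rw [hW_eq, add_quadForm, add_quadForm, ← quadForm_mulVec, ← quadForm_mulVec,
      Matrix.add_mulVec, ← Matrix.mulVec_mulVec]
  refine ⟨W, ?_⟩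
  rintro _ ⟨N, rfl⟩
  rw [le_iff_quadForm_le (isSymm_of_posSemidef (posSemidef_riccatiIter hQ hR N))
    (isSymm_of_posSemidef hW)]
  induction N with
  | zero => simpa [riccatiIter, quadForm] using quadForm_nonneg hW
  | succ N ih =>
    intro x
    rw [riccatiIter_succ, hW_form]
    exact (quadForm_riccatiMap_le hR (posSemidef_riccatiIter hQ hR N) x (K *ᵥ x)).trans
      (by gcongr; exact ih _)

theorem IsStabilizable.exists_tendsto_riccatiIter (hstab : IsStabilizable A B)
    (hQ : Q.PosSemidef) (hR : R.PosDef) :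
    ∃ P, P.PosSemidef ∧ riccatiMap A B Q R P = P ∧ Tendsto (riccatiIter A B Q R) atTop (𝓝 P) := by
  have hpsd := posSemidef_riccatiIter (A := A) (B := B) hQ hR
  obtain ⟨P, hlim⟩ := exists_tendsto_of_monotone (fun N => isSymm_of_posSemidef (hpsd N))
    (monotone_riccatiIter hQ hR) (hstab.bddAbove_range_riccatiIter hQ hR)
  have hP := posSemidef_of_tendsto hpsd hlim
  refine ⟨P, hP, tendsto_nhds_unique ((continuousAt_riccatiMap hR hP).tendsto.comp hlim) ?_, hlim⟩
  exact (hlim.comp (tendsto_add_atTop_nat 1)).congr riccatiIter_succ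

end AlgebraicRiccatiEquation

section IndependentDisturbances

variable {Ω X Y W : Type*} [MeasurableSpace Ω] [MeasurableSpace X] [MeasurableSpace Y]
  [MeasurableSpace W] {Pr : Measure Ω}

theorem lintegral_prodMk_of_indepFun [IsFiniteMeasure Pr] {ξ : Ω → X} {η : Ω → Y}
    (hξ : Measurable ξ) (hη : Measurable η) (hind : IndepFun ξ η Pr) {h : X × Y → ℝ≥0∞}
    (hh : Measurable h) : ∫⁻ ω, h (ξ ω, η ω) ∂Pr = ∫⁻ ω, ∫⁻ y, h (ξ ω, y) ∂Pr.map η ∂Pr := by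
  rw [← lintegral_map hh (hξ.prodMk hη),
    (indepFun_iff_map_prod_eq_prod_map_map hξ.aemeasurable hη.aemeasurable).mp hind,
    lintegral_prod _ hh.aemeasurable, lintegral_map hh.lintegral_prod_right' hξ]

/-- The random variables `w₀, w₁, …` are independent and identically distributed under `Pr`. -/
structure IsIID (w : ℕ → Ω → W) (Pr : Measure Ω) : Prop where
  measurable (k : ℕ) : Measurable (w k)
  iIndepFun : iIndepFun w Pr
  identDistrib (k : ℕ) : IdentDistrib (w k) (w 0) Pr Pr

namespace IsIID

variable {w : ℕ → Ω → W} (hw : IsIID w Pr)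
include hw

theorem measurable_process : Measurable fun ω k => w k ω := measurable_pi_lambda _ hw.measurable

theorem measurable_tail : Measurable fun ω k => w (k + 1) ω :=
  measurable_pi_lambda _ fun _ => hw.measurable _

theorem indepFun_zero_tail : IndepFun (w 0) (fun ω k => w (k + 1) ω) Pr := by
  have hsplit := indep_iSup_of_disjoint (fun k => (hw.measurable k).comap_le) hw.iIndepFun.iIndep
    (S := {0}) (T := {0}ᶜ) disjoint_compl_right
  rw [IndepFun_iff_Indep]
  refine indep_of_indep_of_le_left (indep_of_indep_of_le_right hsplit ?_) ?_
  · rw [MeasurableSpace.pi, MeasurableSpace.comap_iSup]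
    refine iSup_le fun k => ?_
    rw [MeasurableSpace.comap_comp]
    exact le_iSup₂_of_le (k + 1) (Nat.succ_ne_zero k) le_rfl
  · exact le_iSup₂_of_le 0 rfl le_rfl

theorem map_tail : Pr.map (fun ω k => w (k + 1) ω) = Pr.map (fun ω k => w k ω) := by
  have htail : ProbabilityTheory.iIndepFun (fun k => w (k + 1)) Pr :=
    hw.iIndepFun.precomp (add_left_injective 1)
  rw [htail.map_fun_eq_infinitePi_map fun k => hw.measurable _,
    hw.iIndepFun.map_fun_eq_infinitePi_map hw.measurable]
  simp only [(hw.identDistrib _).map_eq]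

theorem lintegral_zero_tail {h : W × (ℕ → W) → ℝ≥0∞} (hh : Measurable h) :
    ∫⁻ ω, h (w 0 ω, fun k => w (k + 1) ω) ∂Pr =
      ∫⁻ ω, ∫⁻ ω', h (w 0 ω, fun k => w k ω') ∂Pr ∂Pr := by
  have := hw.iIndepFun.isProbabilityMeasure
  rw [lintegral_prodMk_of_indepFun (hw.measurable 0) hw.measurable_tail hw.indepFun_zero_tail hh,
    hw.map_tail]
  exact lintegral_congr fun ω =>
    lintegral_map (hh.comp measurable_prodMk_left) hw.measurable_process

end IsIID

end IndependentDisturbances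

section DynamicProgramming

variable {Ω X U W : Type*} [MeasurableSpace Ω] {Pr : Measure Ω}
  {f : X → U → W → X} {ℓ : X → U → ℝ} {γ : ℝ} {w : ℕ → Ω → W}

variable (Pr f ℓ γ w) in
/-- The state-action value `ℓ (x, u) + γ E[V (f (x, u, w₀))]` of the continuation value `V`. -/
noncomputable def qValue (V : X → ℝ≥0∞) (x : X) (u : U) : ℝ≥0∞ :=
  ENNReal.ofReal (ℓ x u) + ENNReal.ofReal γ * ∫⁻ ω, V (f x u (w 0 ω)) ∂Pr

theorem qValue_mono {V V' : X → ℝ≥0∞} (hV : ∀ x, V x ≤ V' x) (x : X) (u : U) :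
    qValue Pr f ℓ γ w V x u ≤ qValue Pr f ℓ γ w V' x u := by
  unfold qValue
  gcongr
  exact hV _

variable [MeasurableSpace X] [MeasurableSpace U]

/-- The policy `(π₁, π₂, …)` that remains after the first step. -/
def Policy.shift (π : Policy X U) : Policy X U :=
  ⟨fun k => π.act (k + 1), fun k => π.measurable_act (k + 1)⟩

/-- The policy that takes the action `u` at the first step, whatever the state, and then follows
`π`. -/
def Policy.cons (u : U) (π : Policy X U) : Policy X U :=
  ⟨fun k => k.casesOn (fun _ => u) π.act, fun k => k.casesOn measurable_const π.measurable_act⟩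

theorem trajectory_succ_eq_shift (π : Policy X U) (x : X) (w : ℕ → W) (k : ℕ) :
    trajectory f π x w (k + 1) =
      trajectory f π.shift (f x (π.act 0 x) (w 0)) (fun j => w (j + 1)) k := by
  induction k with
  | zero => rfl
  | succ k ih => rw [trajectory, ih]; rfl

variable (Pr f ℓ γ w) in
/-- The expected discounted cost `E[γᵏ ℓ (x_k, u_k)]` of the `k`-th step of `π` from the
state `x`. -/
noncomputable def expectedStageCost (π : Policy X U) (k : ℕ) (x : X) : ℝ≥0∞ :=
  ∫⁻ ω, ENNReal.ofReal (γ ^ k * ℓ (trajectory f π x (fun j => w j ω) k)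
    (π.act k (trajectory f π x (fun j => w j ω) k))) ∂Pr

theorem expectedStageCost_zero [IsProbabilityMeasure Pr] (π : Policy X U) (x : X) :
    expectedStageCost Pr f ℓ γ w π 0 x = ENNReal.ofReal (ℓ x (π.act 0 x)) := by
  simp [expectedStageCost, trajectory]

variable [MeasurableSpace W]

theorem measurable_trajectory (hf : Measurable fun p : X × U × W => f p.1 p.2.1 p.2.2)
    (π : Policy X U) (k : ℕ) : Measurable fun p : X × (ℕ → W) => trajectory f π p.1 p.2 k := by
  induction k with
  | zero => exact measurable_fst
  | succ k ih =>
    exact hf.comp (ih.prodMk (((π.measurable_act k).comp ih).prodMk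
      ((measurable_pi_apply k).comp measurable_snd)))

theorem measurable_nextState (hf : Measurable fun p : X × U × W => f p.1 p.2.1 p.2.2) (x : X)
    (u : U) : Measurable fun v => f x u v :=
  hf.comp (measurable_const.prodMk (measurable_const.prodMk measurable_id))

section MeasurableSystem

variable (hf : Measurable fun p : X × U × W => f p.1 p.2.1 p.2.2)
  (hℓ : Measurable fun p : X × U => ℓ p.1 p.2)
include hf hℓ

theorem measurable_stageCost (π : Policy X U) (k : ℕ) :
    Measurable fun p : X × (ℕ → W) => ENNReal.ofReal
      (γ ^ k * ℓ (trajectory f π p.1 p.2 k) (π.act k (trajectory f π p.1 p.2 k))) :=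
  have htraj := measurable_trajectory hf π k
  ENNReal.measurable_ofReal.comp
    ((hℓ.comp (htraj.prodMk ((π.measurable_act k).comp htraj))).const_mul _)

theorem measurable_pathCost (π : Policy X U) :
    Measurable fun p : X × (ℕ → W) => pathCost f ℓ γ π p.1 p.2 :=
  Measurable.tsum fun k => measurable_stageCost hf hℓ π k

theorem measurable_expectedStageCost [SFinite Pr] (hw : ∀ k, Measurable (w k)) (π : Policy X U)
    (k : ℕ) : Measurable (expectedStageCost Pr f ℓ γ w π k) :=
  ((measurable_stageCost hf hℓ π k).comp (measurable_fst.prodMk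
    (measurable_pi_lambda _ fun j => (hw j).comp measurable_snd))).lintegral_prod_right'

theorem value_eq_tsum (hw : ∀ k, Measurable (w k)) (π : Policy X U) (x : X) :
    value Pr f ℓ γ w π x = ∑' k, expectedStageCost Pr f ℓ γ w π k x :=
  lintegral_tsum fun k => ((measurable_stageCost hf hℓ π k).comp
    (measurable_const.prodMk (measurable_pi_lambda _ hw))).aemeasurable

theorem cost_eq_lintegral_value [IsFiniteMeasure Pr] (hw : ∀ k, Measurable (w k))
    {x₀ : Ω → X} (hx₀ : Measurable x₀) (hind : IndepFun x₀ (fun ω k => w k ω) Pr)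
    (π : Policy X U) :
    cost Pr f ℓ γ x₀ w π = ∫⁻ ω, value Pr f ℓ γ w π (x₀ ω) ∂Pr := by
  have hpath := measurable_pathCost (γ := γ) hf hℓ π
  have hprocess : Measurable fun ω k => w k ω := measurable_pi_lambda _ hw
  refine (lintegral_prodMk_of_indepFun hx₀ hprocess hind hpath).trans ?_
  exact lintegral_congr fun ω => lintegral_map (hpath.comp measurable_prodMk_left) hprocess

theorem iInf_cost_eq_lintegral_optimalValue [IsFiniteMeasure Pr] (hw : ∀ k, Measurable (w k))
    {x₀ : Ω → X} (hx₀ : Measurable x₀) (hind : IndepFun x₀ (fun ω k => w k ω) Pr)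
    {π : Policy X U} (hπ : ∀ x, value Pr f ℓ γ w π x = optimalValue Pr f ℓ γ w x) :
    (⨅ π, cost Pr f ℓ γ x₀ w π) = ∫⁻ ω, optimalValue Pr f ℓ γ w (x₀ ω) ∂Pr := by
  simp only [cost_eq_lintegral_value hf hℓ hw hx₀ hind]
  refine le_antisymm (iInf_le_of_le π ?_) (le_iInf fun π' => lintegral_mono fun ω => iInf_le _ π')
  simp only [hπ, le_refl]

variable (hγ : 0 ≤ γ) (hw : IsIID w Pr)
include hγ hw

theorem expectedStageCost_succ (π : Policy X U) (k : ℕ) (x : X) :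
    expectedStageCost Pr f ℓ γ w π (k + 1) x = ENNReal.ofReal γ *
      ∫⁻ ω, expectedStageCost Pr f ℓ γ w π.shift k (f x (π.act 0 x) (w 0 ω)) ∂Pr := by
  have htail : Measurable fun p : W × (ℕ → W) => ENNReal.ofReal (γ ^ k *
      ℓ (trajectory f π.shift (f x (π.act 0 x) p.1) p.2 k)
        (π.shift.act k (trajectory f π.shift (f x (π.act 0 x) p.1) p.2 k))) :=
    (measurable_stageCost hf hℓ π.shift k).comp
      (((measurable_nextState hf x _).comp measurable_fst).prodMk measurable_snd)
  refine Eq.trans (lintegral_congr fun ω => ?_) ((lintegral_const_mul _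
    (htail.comp ((hw.measurable 0).prodMk hw.measurable_tail))).trans
      (congrArg _ (hw.lintegral_zero_tail htail)))
  rw [trajectory_succ_eq_shift, Function.comp_apply, ← ENNReal.ofReal_mul hγ, pow_succ', mul_assoc]
  rfl

theorem sum_range_succ_expectedStageCost (π : Policy X U) (N : ℕ) (x : X) :
    ∑ k ∈ Finset.range (N + 1), expectedStageCost Pr f ℓ γ w π k x =
      qValue Pr f ℓ γ w (fun y => ∑ k ∈ Finset.range N, expectedStageCost Pr f ℓ γ w π.shift k y)
        x (π.act 0 x) := by
  have := hw.iIndepFun.isProbabilityMeasure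
  have hmeas (k : ℕ) : Measurable fun ω =>
      expectedStageCost Pr f ℓ γ w π.shift k (f x (π.act 0 x) (w 0 ω)) :=
    (measurable_expectedStageCost hf hℓ hw.measurable π.shift k).comp
      ((measurable_nextState hf x _).comp (hw.measurable 0))
  rw [Finset.sum_range_succ', expectedStageCost_zero, add_comm, qValue,
    lintegral_finsetSum _ fun k _ => hmeas k, Finset.mul_sum]
  simp only [expectedStageCost_succ hf hℓ hγ hw]

theorem value_eq_qValue (π : Policy X U) (x : X) :
    value Pr f ℓ γ w π x = qValue Pr f ℓ γ w (value Pr f ℓ γ w π.shift) x (π.act 0 x) := by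
  have := hw.iIndepFun.isProbabilityMeasure
  have hmeas (k : ℕ) : Measurable fun ω =>
      expectedStageCost Pr f ℓ γ w π.shift k (f x (π.act 0 x) (w 0 ω)) :=
    (measurable_expectedStageCost hf hℓ hw.measurable π.shift k).comp
      ((measurable_nextState hf x _).comp (hw.measurable 0))
  simp only [qValue, value_eq_tsum hf hℓ hw.measurable]
  rw [tsum_eq_zero_add' ENNReal.summable, expectedStageCost_zero,
    lintegral_tsum fun k => (hmeas k).aemeasurable, ← ENNReal.tsum_mul_left]
  simp only [expectedStageCost_succ hf hℓ hγ hw]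

theorem le_value_of_le_qValue {V : ℕ → X → ℝ≥0∞} (hV_zero : ∀ x, V 0 x = 0)
    (hV_succ : ∀ N x u, V (N + 1) x ≤ qValue Pr f ℓ γ w (V N) x u) (N : ℕ) (π : Policy X U)
    (x : X) : V N x ≤ value Pr f ℓ γ w π x := by
  induction N generalizing π x with
  | zero => simp [hV_zero]
  | succ N ih =>
    rw [value_eq_qValue hf hℓ hγ hw]
    exact (hV_succ N x _).trans (qValue_mono (ih π.shift) x _)

theorem value_stationary_le_of_qValue_le {V : X → ℝ≥0∞} {φ : X → U} (hφ : Measurable φ)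
    (hV : ∀ x, qValue Pr f ℓ γ w V x (φ x) ≤ V x) (x : X) :
    value Pr f ℓ γ w (Policy.stationary φ hφ) x ≤ V x := by
  rw [value_eq_tsum hf hℓ hw.measurable]
  refine ENNReal.tsum_le_of_sum_range_le fun N => ?_
  induction N generalizing x with
  | zero => simp
  | succ N ih =>
    rw [sum_range_succ_expectedStageCost hf hℓ hγ hw]
    exact (qValue_mono ih x _).trans (hV x)

theorem le_optimalValue_of_tendsto {V : ℕ → X → ℝ≥0∞} (hV_zero : ∀ x, V 0 x = 0)
    (hV_succ : ∀ N x u, V (N + 1) x ≤ qValue Pr f ℓ γ w (V N) x u) {x : X} {v : ℝ≥0∞}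
    (hlim : Tendsto (fun N => V N x) atTop (𝓝 v)) : v ≤ optimalValue Pr f ℓ γ w x :=
  le_iInf fun π => le_of_tendsto' hlim fun N =>
    le_value_of_le_qValue hf hℓ hγ hw hV_zero hV_succ N π x

theorem optimalValue_eq_of_qValue_le {V : X → ℝ≥0∞} {φ : X → U} (hφ : Measurable φ)
    (hV : ∀ x, qValue Pr f ℓ γ w V x (φ x) ≤ V x) {x : X}
    (hle : V x ≤ optimalValue Pr f ℓ γ w x) : optimalValue Pr f ℓ γ w x = V x :=
  ((iInf_le _ (Policy.stationary φ hφ)).trans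
    (value_stationary_le_of_qValue_le hf hℓ hγ hw hφ hV x)).antisymm hle

theorem value_stationary_eq_optimalValue {V : X → ℝ≥0∞} {φ : X → U} (hφ : Measurable φ)
    (hV : ∀ x, qValue Pr f ℓ γ w V x (φ x) ≤ V x) {x : X}
    (hle : V x ≤ optimalValue Pr f ℓ γ w x) :
    value Pr f ℓ γ w (Policy.stationary φ hφ) x = optimalValue Pr f ℓ γ w x :=
  ((value_stationary_le_of_qValue_le hf hℓ hγ hw hφ hV x).trans hle).antisymm (iInf_le _ _)

theorem satisfiesBellman_optimalValue {φ : X → U} (hφ : Measurable φ)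
    (hopt : ∀ x, value Pr f ℓ γ w (Policy.stationary φ hφ) x = optimalValue Pr f ℓ γ w x) :
    SatisfiesBellman Pr f ℓ γ w (optimalValue Pr f ℓ γ w) := by
  intro x
  have hvalue : value Pr f ℓ γ w (Policy.stationary φ hφ) = optimalValue Pr f ℓ γ w := funext hopt
  refine le_antisymm (le_iInf fun u => ?_) (iInf_le_of_le (φ x) ?_)
  · refine (iInf_le _ (Policy.cons u (Policy.stationary φ hφ))).trans_eq ?_
    rw [value_eq_qValue hf hℓ hγ hw, ← hvalue]
    rfl
  · rw [← hvalue]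
    exact (value_eq_qValue hf hℓ hγ hw (Policy.stationary φ hφ) x).ge

end MeasurableSystem

end DynamicProgramming

section NoiseMoments

variable {Ω ι : Type*} [MeasurableSpace Ω] [Fintype ι] {Pr : Measure Ω} {v : Ω → ι → ℝ}
  {S : Matrix ι ι ℝ}

/-- The random vector `v` is square integrable with mean zero and `E[v vᵀ] = S`. -/
structure IsCenteredWithCovariance (Pr : Measure Ω) (v : Ω → ι → ℝ) (S : Matrix ι ι ℝ) :
    Prop where
  memLp : MemLp v 2 Pr
  integral_eq_zero (i : ι) : ∫ ω, v ω i ∂Pr = 0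
  integral_mul_eq (i j : ι) : ∫ ω, v ω i * v ω j ∂Pr = S i j

namespace IsCenteredWithCovariance

variable (hv : IsCenteredWithCovariance Pr v S)
include hv

theorem integrable_mul (i j : ι) : Integrable (fun ω => v ω i * v ω j) Pr :=
  (hv.memLp.eval i).integrable_mul (hv.memLp.eval j)

theorem isSymm : S.IsSymm :=
  .ext fun i j => by simp only [← hv.integral_mul_eq, mul_comm]

theorem integrable_quadForm (P : Matrix ι ι ℝ) : Integrable (fun ω => quadForm P (v ω)) Pr := by
  simp only [quadForm_eq_sum]
  exact integrable_finsetSum _ fun i _ => integrable_finsetSum _ fun j _ =>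
    (hv.integrable_mul i j).const_mul _

theorem integral_quadForm (P : Matrix ι ι ℝ) :
    ∫ ω, quadForm P (v ω) ∂Pr = (P * S).trace := by
  have hint (i j : ι) := (hv.integrable_mul i j).const_mul (P i j)
  simp only [quadForm_eq_sum]
  rw [integral_finsetSum _ fun i _ => integrable_finsetSum _ fun j _ => hint i j]
  simp only [integral_finsetSum _ fun j _ => hint _ j, integral_const_mul, Matrix.trace,
    Matrix.diag_apply, Matrix.mul_apply, hv.integral_mul_eq]
  exact Finset.sum_congr rfl fun i _ => Finset.sum_congr rfl fun j _ => by rw [hv.isSymm.apply]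

theorem trace_mul_nonneg {P : Matrix ι ι ℝ} (hP : P.PosSemidef) : 0 ≤ (P * S).trace := by
  rw [← hv.integral_quadForm]
  exact integral_nonneg fun ω => quadForm_nonneg hP _

theorem integrable_dotProduct [IsFiniteMeasure Pr] (y : ι → ℝ) :
    Integrable (fun ω => y ⬝ᵥ v ω) Pr :=
  integrable_finsetSum _ fun i _ => ((hv.memLp.eval i).integrable one_le_two).const_mul _

theorem integral_dotProduct [IsFiniteMeasure Pr] (y : ι → ℝ) : ∫ ω, y ⬝ᵥ v ω ∂Pr = 0 := by
  simp only [dotProduct]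
  rw [integral_finsetSum _ fun i _ =>
    ((hv.memLp.eval i).integrable one_le_two).const_mul _]
  simp only [integral_const_mul, hv.integral_eq_zero, mul_zero, Finset.sum_const_zero]

theorem lintegral_quadForm_add [IsProbabilityMeasure Pr] {P : Matrix ι ι ℝ}
    (hP : P.PosSemidef) {c : ℝ} (hc : 0 ≤ c) (y : ι → ℝ) :
    ∫⁻ ω, ENNReal.ofReal (1 / 2 * (quadForm P (y + v ω) + c)) ∂Pr =
      ENNReal.ofReal (1 / 2 * (quadForm P y + (P * S).trace + c)) := by
  have hsymm := isSymm_of_posSemidef hP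
  have hexpand (ω : Ω) : 1 / 2 * (quadForm P (y + v ω) + c) =
      1 / 2 * (quadForm P y + c) + (y ᵥ* P) ⬝ᵥ v ω + 1 / 2 * quadForm P (v ω) := by
    rw [quadForm_add hsymm, Matrix.dotProduct_mulVec]
    ring
  have hlin : Integrable (fun ω => 1 / 2 * (quadForm P y + c) + (y ᵥ* P) ⬝ᵥ v ω) Pr :=
    (integrable_const _).add (hv.integrable_dotProduct _)
  have hquad : Integrable (fun ω => 1 / 2 * quadForm P (v ω)) Pr :=
    (hv.integrable_quadForm P).const_mul _
  have hint : Integrable (fun ω => 1 / 2 * (quadForm P (y + v ω) + c)) Pr := by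
    simp only [hexpand]
    exact hlin.add hquad
  have hnonneg (ω : Ω) : 0 ≤ 1 / 2 * (quadForm P (y + v ω) + c) := by
    have := quadForm_nonneg hP (y + v ω)
    positivity
  rw [← ofReal_integral_eq_lintegral_ofReal hint (ae_of_all _ hnonneg)]
  congr 1
  simp only [hexpand]
  rw [integral_add hlin hquad, integral_add (integrable_const _) (hv.integrable_dotProduct _),
    integral_dotProduct hv, integral_const, probReal_univ, one_smul,
    integral_const_mul (1 / 2) fun ω => quadForm P (v ω), hv.integral_quadForm]
  ring

end IsCenteredWithCovariance

end NoiseMoments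

section DiscountedAccumulation

/-- The total `∑_{j < N} γ^(N - j) t_j`, given by its recursion: the constant term of the `N`-step
cost-to-go when the noise contributes `t_j` with `j` steps to go. -/
def discountedTotal (γ : ℝ) (t : ℕ → ℝ) : ℕ → ℝ
  | 0 => 0
  | N + 1 => γ * (t N + discountedTotal γ t N)

theorem discountedTotal_nonneg {γ : ℝ} (hγ : 0 ≤ γ) {t : ℕ → ℝ} (ht : ∀ N, 0 ≤ t N) (N : ℕ) :
    0 ≤ discountedTotal γ t N := by
  induction N with
  | zero => exact le_rfl
  | succ N ih => exact mul_nonneg hγ (add_nonneg (ht N) ih)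

theorem tendsto_discountedTotal {γ : ℝ} (hγ : |γ| < 1) {t : ℕ → ℝ} {τ : ℝ}
    (ht : Tendsto t atTop (𝓝 τ)) :
    Tendsto (discountedTotal γ t) atTop (𝓝 (γ / (1 - γ) * τ)) := by
  have hγ_ne : 1 - γ ≠ 0 := sub_ne_zero.mpr (lt_of_abs_lt hγ).ne'
  have herror (N : ℕ) : discountedTotal γ t (N + 1) - γ / (1 - γ) * τ =
      (γ • ContinuousLinearMap.id ℝ ℝ) (discountedTotal γ t N - γ / (1 - γ) * τ)
        + γ * (t N - τ) := by
    simp only [discountedTotal, smul_apply, ContinuousLinearMap.id_apply,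
      smul_eq_mul]
    field_simp
    ring
  have hpow : Summable fun k => ‖(γ • ContinuousLinearMap.id ℝ ℝ) ^ k‖ := by
    simpa [smul_pow, norm_smul, ← ContinuousLinearMap.one_def] using
      summable_geometric_of_lt_one (abs_nonneg γ) hγ
  have hforcing : Tendsto (fun N => γ * (t N - τ)) atTop (𝓝 0) := by
    simpa using (ht.sub_const τ).const_mul γ
  have hzero := tendsto_zero_of_affine_recursion
    (z := fun N => discountedTotal γ t N - γ / (1 - γ) * τ) hpow herror hforcing
  simpa using hzero.add_const (γ / (1 - γ) * τ)

end DiscountedAccumulation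

section LinearQuadratic

variable {n m : ℕ} {A : Matrix (Fin n) (Fin n) ℝ} {B : Matrix (Fin n) (Fin m) ℝ}
  {Q : Matrix (Fin n) (Fin n) ℝ} {R : Matrix (Fin m) (Fin m) ℝ} {γ : ℝ}
  {P S : Matrix (Fin n) (Fin n) ℝ}

theorem measurable_linearDynamics :
    Measurable fun p : (Fin n → ℝ) × (Fin m → ℝ) × (Fin n → ℝ) =>
      linearDynamics A B p.1 p.2.1 p.2.2 := by
  unfold linearDynamics
  exact Continuous.measurable (by fun_prop)

theorem measurable_quadraticCost :
    Measurable fun p : (Fin n → ℝ) × (Fin m → ℝ) => quadraticCost Q R p.1 p.2 := by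
  unfold quadraticCost
  exact Continuous.measurable (by fun_prop)

theorem quadraticCost_eq (x : Fin n → ℝ) (u : Fin m → ℝ) :
    quadraticCost Q R x u = 1 / 2 * (quadForm Q x + quadForm R u) := rfl

theorem quadraticValue_eq (x : Fin n → ℝ) :
    quadraticValue γ P S x = 1 / 2 * (quadForm P x + γ / (1 - γ) * (P * S).trace) := rfl

theorem quadraticCost_nonneg (hQ : Q.PosSemidef) (hR : R.PosSemidef) (x : Fin n → ℝ)
    (u : Fin m → ℝ) : 0 ≤ quadraticCost Q R x u := by
  have := quadForm_nonneg hQ x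
  have := quadForm_nonneg hR u
  rw [quadraticCost_eq]
  positivity

theorem solvesRiccati_iff :
    SolvesRiccati A B Q R γ P ↔ riccatiMap (√γ • A) B Q ((1 / γ) • R) P = P := by
  rw [← sub_eq_zero (b := P), SolvesRiccati, riccatiMap]
  exact Eq.congr_left (by abel)

theorem posDef_one_div_smul (hR : R.PosDef) (hγ : 0 < γ) : ((1 / γ) • R).PosDef :=
  hR.smul (one_div_pos.mpr hγ)

theorem riccatiGain_sqrt_smul (hR : R.PosDef) (hγ : 0 < γ) (hP : P.PosSemidef) :
    riccatiGain (√γ • A) B ((1 / γ) • R) P = √γ • optimalGain A B R γ P := by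
  have hM := posDef_transpose_mul_mul_add (B := B) (posDef_one_div_smul hR hγ) hP
  have hscale : R + γ • (Bᵀ * P * B) = γ • (Bᵀ * P * B + (1 / γ) • R) := by
    rw [smul_add, smul_smul, mul_one_div_cancel hγ.ne', one_smul, add_comm]
  have := invertibleOfNonzero hγ.ne'
  rw [riccatiGain, optimalGain, hscale,
    Matrix.inv_smul _ γ ((Matrix.isUnit_iff_isUnit_det _).mp hM.isUnit), Matrix.mul_smul,
    Matrix.mul_smul, Matrix.smul_mul, Matrix.mul_smul, smul_smul (⅟γ), invOf_mul_self, one_smul,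
    smul_neg]

theorem quadForm_discounted_step_eq (hR : R.PosDef) (hγ : 0 < γ) (hP : P.PosSemidef)
    (x : Fin n → ℝ) (u : Fin m → ℝ) :
    quadForm Q x + quadForm R u + γ * quadForm P (A *ᵥ x + B *ᵥ u) =
      quadForm (riccatiMap (√γ • A) B Q ((1 / γ) • R) P) x +
        γ * quadForm (Bᵀ * P * B + (1 / γ) • R) (u - optimalGain A B R γ P *ᵥ x) := by
  have hstep := quadForm_step_eq (A := √γ • A) (B := B) (Q := Q) (posDef_one_div_smul hR hγ) hP x
    (√γ • u)
  rw [riccatiGain_sqrt_smul hR hγ hP, Matrix.smul_mulVec, Matrix.smul_mulVec, Matrix.mulVec_smul,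
    ← smul_add, ← smul_sub] at hstep
  simpa only [quadForm_smul, smul_quadForm, Real.sq_sqrt hγ.le, ← mul_assoc,
    mul_one_div_cancel hγ.ne', one_mul] using hstep

variable {Ω : Type*} [MeasurableSpace Ω] {Pr : Measure Ω} [IsProbabilityMeasure Pr]
  {w : ℕ → Ω → Fin n → ℝ}

section BellmanStep

variable (hQ : Q.PosSemidef) (hR : R.PosDef) (hw : IsCenteredWithCovariance Pr (w 0) S)
include hQ hR hw

theorem qValue_quadForm_add (hγ : 0 < γ) (hP : P.PosSemidef) {c : ℝ} (hc : 0 ≤ c)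
    (x : Fin n → ℝ) (u : Fin m → ℝ) :
    qValue Pr (linearDynamics A B) (quadraticCost Q R) γ w
        (fun y => ENNReal.ofReal (1 / 2 * (quadForm P y + c))) x u =
      ENNReal.ofReal (1 / 2 * (quadForm (riccatiMap (√γ • A) B Q ((1 / γ) • R) P) x +
        γ * quadForm (Bᵀ * P * B + (1 / γ) • R) (u - optimalGain A B R γ P *ᵥ x) +
        γ * ((P * S).trace + c))) := by
  have hform := quadForm_nonneg hP (A *ᵥ x + B *ᵥ u)
  have htrace := hw.trace_mul_nonneg hP
  simp only [qValue, linearDynamics]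
  rw [hw.lintegral_quadForm_add hP hc, ← ENNReal.ofReal_mul hγ.le,
    ← ENNReal.ofReal_add (quadraticCost_nonneg hQ hR.posSemidef x u) (by positivity),
    ← quadForm_discounted_step_eq hR hγ hP, quadraticCost_eq]
  congr 1
  ring

theorem le_qValue_quadForm_add (hγ : 0 < γ) (hP : P.PosSemidef) {c : ℝ} (hc : 0 ≤ c)
    (x : Fin n → ℝ) (u : Fin m → ℝ) :
    ENNReal.ofReal (1 / 2 * (quadForm (riccatiMap (√γ • A) B Q ((1 / γ) • R) P) x +
        γ * ((P * S).trace + c))) ≤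
      qValue Pr (linearDynamics A B) (quadraticCost Q R) γ w
        (fun y => ENNReal.ofReal (1 / 2 * (quadForm P y + c))) x u := by
  have hM := posDef_transpose_mul_mul_add (B := B) (posDef_one_div_smul hR hγ) hP
  have hgap := mul_nonneg hγ.le
    (quadForm_nonneg hM.posSemidef (u - optimalGain A B R γ P *ᵥ x))
  rw [qValue_quadForm_add hQ hR hw hγ hP hc]
  exact ENNReal.ofReal_le_ofReal (by linarith)

variable (hγ : γ ∈ Set.Ioo (0 : ℝ) 1) (hP : P.PosSemidef) (hsol : SolvesRiccati A B Q R γ P)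
include hγ hP hsol

theorem qValue_quadraticValue (x : Fin n → ℝ) (u : Fin m → ℝ) :
    qValue Pr (linearDynamics A B) (quadraticCost Q R) γ w
        (fun y => ENNReal.ofReal (quadraticValue γ P S y)) x u =
      ENNReal.ofReal (quadraticValue γ P S x + γ / 2 *
        quadForm (Bᵀ * P * B + (1 / γ) • R) (u - optimalGain A B R γ P *ᵥ x)) := by
  have hγ_sub : 0 < 1 - γ := sub_pos.mpr hγ.2
  simp only [quadraticValue_eq]
  rw [qValue_quadForm_add hQ hR hw hγ.1 hP
    (mul_nonneg (div_nonneg hγ.1.le hγ_sub.le) (hw.trace_mul_nonneg hP)), solvesRiccati_iff.mp hsol]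
  congr 1
  field_simp
  ring

theorem qValue_quadraticValue_eq_iff (x : Fin n → ℝ) (u : Fin m → ℝ) :
    qValue Pr (linearDynamics A B) (quadraticCost Q R) γ w
        (fun y => ENNReal.ofReal (quadraticValue γ P S y)) x u =
      ENNReal.ofReal (quadraticValue γ P S x) ↔ u = optimalGain A B R γ P *ᵥ x := by
  have hM := posDef_transpose_mul_mul_add (B := B) (posDef_one_div_smul hR hγ.1) hP
  have hgap := mul_nonneg (div_nonneg hγ.1.le zero_le_two)
    (quadForm_nonneg hM.posSemidef (u - optimalGain A B R γ P *ᵥ x))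
  have hvalue : 0 ≤ quadraticValue γ P S x := by
    have hform := quadForm_nonneg hP x
    have htrace := hw.trace_mul_nonneg hP
    have hγ_pos := hγ.1
    have hγ_sub := sub_pos.mpr hγ.2
    rw [quadraticValue_eq]
    positivity
  rw [qValue_quadraticValue hQ hR hw hγ hP hsol,
    ENNReal.ofReal_eq_ofReal_iff (add_nonneg hvalue hgap) hvalue, add_eq_left, mul_eq_zero,
    or_iff_right (div_ne_zero hγ.1.ne' two_ne_zero), quadForm_eq_zero_iff hM, sub_eq_zero]

end BellmanStep

variable (hQ : Q.PosSemidef) (hR : R.PosDef) (hγ : γ ∈ Set.Ioo (0 : ℝ) 1)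
  (hiid : IsIID w Pr) (hw : IsCenteredWithCovariance Pr (w 0) S) (hP : P.PosSemidef)
  (hsol : SolvesRiccati A B Q R γ P)
include hQ hR hγ hiid hw

/-- Value iteration from zero keeps the value function of the form `½ (xᵀ P_N x + c_N)`. -/
theorem quadraticValue_le_optimalValue
    (hlim : Tendsto (riccatiIter (√γ • A) B Q ((1 / γ) • R)) atTop (𝓝 P)) (x : Fin n → ℝ) :
    ENNReal.ofReal (quadraticValue γ P S x) ≤
      optimalValue Pr (linearDynamics A B) (quadraticCost Q R) γ w x := by
  set PN := riccatiIter (√γ • A) B Q ((1 / γ) • R) with hPN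
  have hPN_psd (N : ℕ) : (PN N).PosSemidef :=
    posSemidef_riccatiIter hQ (posDef_one_div_smul hR hγ.1) N
  set c := discountedTotal γ fun N => (PN N * S).trace with hc
  have hc_nonneg := discountedTotal_nonneg hγ.1.le fun N => hw.trace_mul_nonneg (hPN_psd N)
  have hc_lim : Tendsto c atTop (𝓝 (γ / (1 - γ) * (P * S).trace)) := by
    have htrace : Continuous fun M : Matrix (Fin n) (Fin n) ℝ => (M * S).trace := by fun_prop
    exact tendsto_discountedTotal (by rw [abs_of_pos hγ.1]; exact hγ.2)
      ((htrace.tendsto P).comp hlim)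
  refine le_optimalValue_of_tendsto
    (V := fun N y => ENNReal.ofReal (1 / 2 * (quadForm (PN N) y + c N)))
    measurable_linearDynamics measurable_quadraticCost hγ.1.le hiid (fun y => ?_)
    (fun N y u => ?_) (ENNReal.tendsto_ofReal
      (((((continuous_quadForm_left x).tendsto P).comp hlim).add hc_lim).const_mul (1 / 2)))
  · simp [hPN, hc, riccatiIter, discountedTotal, quadForm]
  · rw [hPN, riccatiIter_succ]
    exact le_qValue_quadForm_add hQ hR hw hγ.1 (hPN_psd N) (hc_nonneg N) y u

include hP hsol

theorem optimalValue_eq_quadraticValue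
    (hlim : Tendsto (riccatiIter (√γ • A) B Q ((1 / γ) • R)) atTop (𝓝 P)) (x : Fin n → ℝ) :
    optimalValue Pr (linearDynamics A B) (quadraticCost Q R) γ w x =
      ENNReal.ofReal (quadraticValue γ P S x) :=
  optimalValue_eq_of_qValue_le measurable_linearDynamics measurable_quadraticCost hγ.1.le hiid
    (measurable_mulVec (optimalGain A B R γ P))
    (fun y => ((qValue_quadraticValue_eq_iff hQ hR hw hγ hP hsol y _).mpr rfl).le)
    (quadraticValue_le_optimalValue hQ hR hγ hiid hw hlim x)

theorem value_stationary_eq_optimalValue_iff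
    (hlim : Tendsto (riccatiIter (√γ • A) B Q ((1 / γ) • R)) atTop (𝓝 P))
    {φ : (Fin n → ℝ) → (Fin m → ℝ)} (hφ : Measurable φ) :
    (∀ x, value Pr (linearDynamics A B) (quadraticCost Q R) γ w (Policy.stationary φ hφ) x =
        optimalValue Pr (linearDynamics A B) (quadraticCost Q R) γ w x) ↔
      φ = fun x => optimalGain A B R γ P *ᵥ x := by
  have hopt := optimalValue_eq_quadraticValue hQ hR hγ hiid hw hP hsol hlim
  have hgreedy := qValue_quadraticValue_eq_iff hQ hR hw hγ hP hsol
  constructor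
  · intro hφ_opt
    have hvalue : value Pr (linearDynamics A B) (quadraticCost Q R) γ w
        (Policy.stationary φ hφ) = fun y => ENNReal.ofReal (quadraticValue γ P S y) :=
      funext fun y => (hφ_opt y).trans (hopt y)
    funext x
    rw [← hgreedy, ← congrFun hvalue x]
    conv_rhs => rw [value_eq_qValue measurable_linearDynamics measurable_quadraticCost hγ.1.le hiid]
    rw [← hvalue]
    rfl
  · rintro rfl x
    exact value_stationary_eq_optimalValue measurable_linearDynamics measurable_quadraticCost
      hγ.1.le hiid hφ (fun y => ((hgreedy y _).mpr rfl).le)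
      (quadraticValue_le_optimalValue hQ hR hγ hiid hw hlim x)

end LinearQuadratic

end DiscountedLQR

theorem mainTheorem9_general {Ω : Type*} [MeasurableSpace Ω] (Pr : Measure Ω)
    [IsProbabilityMeasure Pr] (n m : ℕ)
    (A : Matrix (Fin n) (Fin n) ℝ) (B : Matrix (Fin n) (Fin m) ℝ)
    (Q : Matrix (Fin n) (Fin n) ℝ) (R : Matrix (Fin m) (Fin m) ℝ)
    (hQ : Q.PosSemidef) (hR : R.PosDef) (γ : ℝ) (hγ : γ ∈ Set.Ioo (0 : ℝ) 1)
    (x₀ : Ω → Fin n → ℝ) (hx₀ : Measurable x₀) (w : ℕ → Ω → Fin n → ℝ) (hiid : IsIID w Pr)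
    (Sw : Matrix (Fin n) (Fin n) ℝ) (hw : IsCenteredWithCovariance Pr (w 0) Sw)
    (hind : IndepFun x₀ (fun ω k => w k ω) Pr)
    (hstab : IsStabilizable (√γ • A) B) (hdet : IsDetectable (√γ • A) (CFC.sqrt Q)) :
    SatisfiesBellman Pr (linearDynamics A B) (quadraticCost Q R) γ w
      (optimalValue Pr (linearDynamics A B) (quadraticCost Q R) γ w) ∧
    (∃! P : Matrix (Fin n) (Fin n) ℝ, P.PosSemidef ∧ SolvesRiccati A B Q R γ P) ∧
    ∀ P : Matrix (Fin n) (Fin n) ℝ, P.PosSemidef → SolvesRiccati A B Q R γ P →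
      (∀ x, optimalValue Pr (linearDynamics A B) (quadraticCost Q R) γ w x =
        ENNReal.ofReal (quadraticValue γ P Sw x)) ∧
      cost Pr (linearDynamics A B) (quadraticCost Q R) γ x₀ w
          (linearPolicy (optimalGain A B R γ P)) =
        (⨅ π, cost Pr (linearDynamics A B) (quadraticCost Q R) γ x₀ w π) ∧
      (⨅ π, cost Pr (linearDynamics A B) (quadraticCost Q R) γ x₀ w π) =
        ∫⁻ ω, optimalValue Pr (linearDynamics A B) (quadraticCost Q R) γ w (x₀ ω) ∂Pr ∧
      (∀ (φ : (Fin n → ℝ) → (Fin m → ℝ)) (hφ : Measurable φ),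
        (∀ x, value Pr (linearDynamics A B) (quadraticCost Q R) γ w (Policy.stationary φ hφ) x =
          optimalValue Pr (linearDynamics A B) (quadraticCost Q R) γ w x) ↔
        φ = fun x => optimalGain A B R γ P *ᵥ x) := by
  have hf := measurable_linearDynamics (A := A) (B := B)
  have hℓ := measurable_quadraticCost (Q := Q) (R := R)
  have hRγ := posDef_one_div_smul hR hγ.1
  obtain ⟨P₀, hP₀, hfix₀, hlim⟩ := hstab.exists_tendsto_riccatiIter hQ hRγ
  have hsol₀ := solvesRiccati_iff.mpr hfix₀
  have huniq (P : Matrix (Fin n) (Fin n) ℝ) (hP : P.PosSemidef)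
      (hsol : SolvesRiccati A B Q R γ P) : P = P₀ :=
    eq_of_riccatiMap_eq_self hQ hRγ hdet hP hP₀ (solvesRiccati_iff.mp hsol) hfix₀
  have hstationary {φ : (Fin n → ℝ) → (Fin m → ℝ)} (hφ : Measurable φ) :=
    value_stationary_eq_optimalValue_iff hQ hR hγ hiid hw hP₀ hsol₀ hlim hφ
  have hopt := (hstationary (measurable_mulVec (optimalGain A B R γ P₀))).mpr rfl
  refine ⟨satisfiesBellman_optimalValue hf hℓ hγ.1.le hiid (measurable_mulVec _) hopt,
    ⟨P₀, ⟨hP₀, hsol₀⟩, fun P hP => huniq P hP.1 hP.2⟩, fun P hP hsol => ?_⟩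
  obtain rfl := huniq P hP hsol
  have hinf := iInf_cost_eq_lintegral_optimalValue hf hℓ hiid.measurable hx₀ hind hopt
  refine ⟨optimalValue_eq_quadraticValue hQ hR hγ hiid hw hP hsol hlim, ?_, hinf,
    fun φ hφ => hstationary hφ⟩
  rw [hinf, cost_eq_lintegral_value hf hℓ hiid.measurable hx₀ hind]
  exact lintegral_congr fun ω => hopt (x₀ ω)

theorem mainTheorem9 {Ω : Type*} [MeasurableSpace Ω] (Pr : Measure Ω) [IsProbabilityMeasure Pr]
    (n m : ℕ)
    (A : Matrix (Fin n) (Fin n) ℝ) (B : Matrix (Fin n) (Fin m) ℝ)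
    (Q : Matrix (Fin n) (Fin n) ℝ) (R : Matrix (Fin m) (Fin m) ℝ)
    (hQ : Q.PosSemidef) (hR : R.PosDef)
    (γ : ℝ) (hγ : γ ∈ Set.Ioo (0 : ℝ) 1)
    -- the initial state
    (x₀ : Ω → Fin n → ℝ) (hx₀_meas : Measurable x₀) (hx₀_L2 : MemLp x₀ 2 Pr)
    (μ₀ : Fin n → ℝ) (hx₀_mean : ∀ i, ∫ ω, x₀ ω i ∂Pr = μ₀ i)
    (S₀ : Matrix (Fin n) (Fin n) ℝ) (hS₀ : S₀.PosSemidef)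
    (hx₀_cov : ∀ i j, ∫ ω, (x₀ ω i - μ₀ i) * (x₀ ω j - μ₀ j) ∂Pr = S₀ i j)
    -- the disturbances
    (w : ℕ → Ω → Fin n → ℝ) (hw_meas : ∀ k, Measurable (w k)) (hw_L2 : ∀ k, MemLp (w k) 2 Pr)
    (hw_indep : iIndepFun w Pr) (hw_ident : ∀ k, IdentDistrib (w k) (w 0) Pr Pr)
    (hw_mean : ∀ k i, ∫ ω, w k ω i ∂Pr = 0)
    (Sw : Matrix (Fin n) (Fin n) ℝ) (hSw : Sw.PosSemidef)
    (hw_cov : ∀ k i j, ∫ ω, w k ω i * w k ω j ∂Pr = Sw i j)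
    (hx₀_indep : IndepFun x₀ (fun ω k => w k ω) Pr)
    (hstab : IsStabilizable A B) (hdet : IsDetectable A (CFC.sqrt Q)) :
    -- the optimal value function satisfies the Bellman equation
    SatisfiesBellman Pr (linearDynamics A B) (quadraticCost Q R) γ w
      (optimalValue Pr (linearDynamics A B) (quadraticCost Q R) γ w) ∧
    -- the Riccati equation has a unique positive semidefinite solution `P`, and for it:
    (∃! P : Matrix (Fin n) (Fin n) ℝ, P.PosSemidef ∧ SolvesRiccati A B Q R γ P) ∧
    ∀ P : Matrix (Fin n) (Fin n) ℝ, P.PosSemidef → SolvesRiccati A B Q R γ P →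
      -- the optimal value function is the quadratic one
      (∀ x, optimalValue Pr (linearDynamics A B) (quadraticCost Q R) γ w x =
        ENNReal.ofReal (quadraticValue γ P Sw x)) ∧
      -- `J(π_F) = inf_π J(π) = E[V*(x₀)]`
      cost Pr (linearDynamics A B) (quadraticCost Q R) γ x₀ w
          (linearPolicy (optimalGain A B R γ P)) =
        (⨅ π, cost Pr (linearDynamics A B) (quadraticCost Q R) γ x₀ w π) ∧
      (⨅ π, cost Pr (linearDynamics A B) (quadraticCost Q R) γ x₀ w π) =
        ∫⁻ ω, optimalValue Pr (linearDynamics A B) (quadraticCost Q R) γ w (x₀ ω) ∂Pr ∧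
      -- `(π_F, π_F, …)` attains `V*` at every state, and no other time-invariant policy does
      (∀ (φ : (Fin n → ℝ) → (Fin m → ℝ)) (hφ : Measurable φ),
        (∀ x, value Pr (linearDynamics A B) (quadraticCost Q R) γ w (Policy.stationary φ hφ) x =
          optimalValue Pr (linearDynamics A B) (quadraticCost Q R) γ w x) ↔
        φ = fun x => optimalGain A B R γ P *ᵥ x) := by
  have hγ_sqrt : |√γ| ≤ 1 := by simp [abs_of_nonneg (Real.sqrt_nonneg γ), hγ.2.le]
  exact mainTheorem9_general Pr n m A B Q R hQ hR γ hγ x₀ hx₀_meas w ⟨hw_meas, hw_indep, hw_ident⟩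
    Sw ⟨hw_L2 0, hw_mean 0, hw_cov 0⟩ hx₀_indep (hstab.smul hγ_sqrt) (hdet.smul hγ_sqrt)
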